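/- **Setting.** For $d\ge 1$ let $L_2^d=L_2([0,\infty),\mathbb R^d)$, let $(P_Tu)(t)=u(t)$ for $t\le T$ and $0$ for $t>T$, and let $L_{2e}^d$ be the space of signals $u$ with $P_Tu\in L_2^d$ for all $T\ge 0$. An operator $R:L_2^p\to L_2^q$ is *causal* if $P_TRu=P_TRP_Tu$ for all $u\in L_2^p$, $T\ge0$; it is then extended to $L_{2e}^p\to L_{2e}^q$ by $P_TRu:=P_TRP_Tu$. Its incremental gain is $\Gamma(R)=\sup_{u_1\ne u_2}\|Ru_1-Ru_2\|/\|u_1-u_2\|\in[0,\infty]$. For $H_1:L_2^p\to L_2^q$ and $H_2:L_2^q\to L_2^p$, the interconnection $[H_1,H_2]=(H_1^{-1}+H_2)^{-1}$ is *well-posed on $L_2$* if for every $u\in L_2^p$ there are unique $e\in L_2^p$, $y\in L_2^q$ with $e=u-H_2y$, $y=H_1e$; for causal $H_1,H_2$ it is *well-posed in the extended spaces* if for every $u\in L_2^p$ there are unique $e\in L_{2e}^p$, $y\in L_{2e}^q$ with these equations. Inverses, sums and products of operators are understood as inverses, sums and compositions of relations. **Scaled relative graph.** For $R:L_2^p\to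 L_2^q$ put $n=\max\{p,q\}$, embed $L_2^p$ and $L_2^q$ in $L_2^n$ by appending zero components, and let $$\mathrm{SRG}(R)=\Big\{\tfrac{\|\Delta y\|}{\|\Delta u\|}e^{\pm j\theta}\ :\ u_1\ne u_2\in L_2^p,\ \Delta u=u_1-u_2,\ \Delta y=Ru_1-Ru_2,\ \cos\theta=\tfrac{\langle\Delta u,\Delta y\rangle}{\|\Delta u\|\|\Delta y\|},\ \theta\in[0,\pi]\Big\}$$ (norms and inner products in $L_2^n$; the point is $0$ if $\Delta y=0$). For subsets of $\mathbb C\cup\{\infty\}$, sums and products are elementwise, with $\infty+z=\infty+\infty=\infty$ and $\infty\cdot z=\infty\cdot\infty=\infty$ (also for $z=0$), and $C^{-1}$ is the image of $C$ under $re^{j\phi}\mapsto r^{-1}e^{j\phi}$, $0\leftrightarrow\infty$. Let $C^{c}$, $C^{+}$, $C^{-}$ be the unions over $z\in C$ of the chords $[z,\bar z]$, of the right arcs $\mathrm{Arc}^+(z,\bar z)=\{re^{j(1-2\alpha)\phi}:\alpha\in[0,1]\}$ (where $z=re^{j\phi}$, $\phi\in(-\pi,\pi]$), and of the left arcs $\mathrm{Arc}^-(z,\bar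 z)=-\mathrm{Arc}^+(-z,-\bar z)$, where $\infty\in C$ contributes just $\infty$. Put $$\overline{C_1+C_2}=(C_1^c+C_2)\cap(C_1+C_2^c),\qquad \overline{C_1C_2}=(C_1^+C_2)\cap(C_1C_2^+)\cap(C_1^-C_2)\cap(C_1C_2^-).$$ The radius of $C$ is $\inf\{r>0: C\subseteq\{|z|\le r\}\}\in[0,\infty]$ (it is $\infty$ if $\infty\in C$). **Theorem.** Let $n_z,n_w,p,q\ge1$, let $G=\begin{pmatrix}G_{zw}&G_{zu}\\G_{yw}&G_{yu}\end{pmatrix}\in RH_\infty^{(n_z+q)\times(n_w+p)}$ (real rational, proper, all poles in $\mathrm{Re}\,s<0$; its blocks are identified with the causal bounded operators on $L_2$ that they define), and let $\Phi:L_2^{n_z}\to L_2^{n_w}$ satisfy $\Gamma(\Phi)<\infty$. Let $$R=G_{yw}(\Phi^{-1}-G_{zw})^{-1}G_{zu}+G_{yu}$$ and, for $\tau\in[0,1]$, $$\mathcal A_\tau=\overline{\mathrm{SRG}(\Phi)^{-1}-\tau\,\mathrm{SRG}(G_{zw})},\qquad \mathcal G_{R,\tau}=\overline{\mathrm{SRG}(G_{yu})+\overline{\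 \overline{\mathrm{SRG}(G_{yw})\,\mathcal A_\tau^{-1}}\ \mathrm{SRG}(G_{zu})}}.$$ Suppose that for some $\hat\Gamma\in[0,\infty)$ the radius of $\mathcal G_{R,\tau}$ is at most $\hat\Gamma$ for every $\tau\in[0,1]$. 1. If neither $G_{yw}$ nor $G_{zu}$ is the zero operator, then $[\Phi,-G_{zw}]$ is well-posed on $L_2$, and also in the extended spaces if $\Phi$ is causal; the relation $R$ is (the graph of) an operator $R:L_2^p\to L_2^q$ defined on all of $L_2^p$; $\Gamma(R)\le\hat\Gamma$; and $R$ is causal if $\Phi$ is causal. 2. If $G_{yw}=0$ or $G_{zu}=0$, so that $R$ is read as $G_{yu}$, then $\Gamma(G_{yu})\le\hat\Gamma$ and $G_{yu}$ is causal. If moreover $[\Phi,-G_{zw}]$ is well-posed on $L_2$, then $R$ is an operator $L_2^p\to L_2^q$ with $\Gamma(R)\le\hat\Gamma$, causal if $\Phi$ is causal. -/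

import Mathlib

open MeasureTheory Set
open scoped NNReal ENNReal Matrix Polynomial

/-! ### Auxiliary facts: matrix exponentials decay, convolutions are bounded on `L₂` -/

theorem integrableOn_pow_mul_exp (k : ℕ) {b : ℝ} (hb : b < 0) :
    IntegrableOn (fun t : ℝ => t ^ k * Real.exp (b * t)) (Ioi 0) := by
  refine integrable_of_isBigO_exp_neg (b := -b / 2) (by linarith) (by fun_prop) ?_
  have h := (isLittleO_pow_exp_pos_mul_atTop k (b := -b / 2) (by linarith)).isBigO.mul
    (Asymptotics.isBigO_refl (fun t : ℝ => Real.exp (b * t)) Filter.atTop)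
  refine h.congr_right fun t => ?_
  rw [← Real.exp_add]; ring_nf


theorem continuous_exp_smul_entry {n : ℕ} (A : Matrix (Fin n) (Fin n) ℝ) (i j : Fin n) :
    Continuous fun t : ℝ => NormedSpace.exp (t • A) i j := by
  let : NormedRing (Matrix (Fin n) (Fin n) ℝ) := Matrix.linftyOpNormedRing
  let : NormedAlgebra ℝ (Matrix (Fin n) (Fin n) ℝ) := Matrix.linftyOpNormedAlgebra
  let : NormedAlgebra ℚ (Matrix (Fin n) (Fin n) ℝ) := Matrix.linftyOpNormedAlgebra
  have h : Continuous fun t : ℝ => NormedSpace.exp (t • A) :=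
    NormedSpace.exp_continuous.comp (continuous_id.smul continuous_const)
  exact h.matrix_elem i j

theorem exp_smul_mulVec_of_mem_genEigenspace {n : ℕ} (M : Matrix (Fin n) (Fin n) ℂ) (μ : ℂ)
    (v : Fin n → ℂ) (K : ℕ) (hK : ((Matrix.toLin' M - μ • (1 : Module.End ℂ (Fin n → ℂ))) ^ K) v = 0)
    (t : ℝ) :
    NormedSpace.exp ((t : ℂ) • M) *ᵥ v = ∑ k ∈ Finset.range K,
      (((t : ℂ) ^ k * Complex.exp (μ * t) * ((k.factorial : ℂ)⁻¹)) • (((M - μ • 1) ^ k) *ᵥ v)) := by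
  let : NormedRing (Matrix (Fin n) (Fin n) ℂ) := Matrix.linftyOpNormedRing
  let : NormedAlgebra ℂ (Matrix (Fin n) (Fin n) ℂ) := Matrix.linftyOpNormedAlgebra
  let : NormedAlgebra ℚ (Matrix (Fin n) (Fin n) ℂ) := Matrix.linftyOpNormedAlgebra
  have hv : ∀ k, K ≤ k → ((M - μ • 1) ^ k) *ᵥ v = 0 := by
    have e : ∀ k, ((Matrix.toLin' M - μ • (1 : Module.End ℂ (Fin n → ℂ))) ^ k) v
        = ((M - μ • 1) ^ k) *ᵥ v := by
      intro k
      have : Matrix.toLin' M - μ • (1 : Module.End ℂ (Fin n → ℂ)) = Matrix.toLin' (M - μ • 1) := by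
        simp [map_sub]
        rfl
      rw [this, ← Matrix.toLin'_pow, Matrix.toLin'_apply]
    intro k hk
    obtain ⟨d, rfl⟩ := Nat.exists_eq_add_of_le hk
    rw [← e, add_comm, pow_add, Module.End.mul_apply, hK, map_zero]
  have hs : (t : ℂ) • M = (t * μ) • (1 : Matrix (Fin n) (Fin n) ℂ) + (t : ℂ) • (M - μ • 1) := by
    rw [smul_sub, smul_smul]; abel
  have hc : Commute ((t * μ) • (1 : Matrix (Fin n) (Fin n) ℂ)) ((t : ℂ) • (M - μ • 1)) :=
    (Commute.one_left _).smul_left _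
  have h1 : NormedSpace.exp ((t * μ) • (1 : Matrix (Fin n) (Fin n) ℂ)) = Complex.exp (μ * t) • 1 := by
    rw [← Algebra.algebraMap_eq_smul_one]
    have h := NormedSpace.algebraMap_exp_comm (𝕂 := ℂ) (𝔸 := Matrix (Fin n) (Fin n) ℂ) (t * μ)
    rw [← Complex.exp_eq_exp_ℂ, Algebra.algebraMap_eq_smul_one] at h
    rw [mul_comm μ]
    exact h.symm
  have hsum := NormedSpace.exp_series_hasSum_exp' (𝕂 := ℂ) ((t : ℂ) • (M - μ • 1))
  have hsum' : HasSum (fun k : ℕ => ((k.factorial : ℂ)⁻¹ • ((t : ℂ) • (M - μ • 1)) ^ k) *ᵥ v)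
      (NormedSpace.exp ((t : ℂ) • (M - μ • 1)) *ᵥ v) :=
    hsum.map ((Matrix.mulVecBilin ℂ ℂ).flip v).toAddMonoidHom (by
      show Continuous fun X : Matrix (Fin n) (Fin n) ℂ => X *ᵥ v
      fun_prop)
  have hfin := hsum'.unique (hasSum_sum_of_ne_finset_zero (s := Finset.range K) (by
    intro k hk
    rw [smul_pow, Matrix.smul_mulVec, Matrix.smul_mulVec, hv k (by simpa using hk)]
    simp))
  have hexp : NormedSpace.exp ((t : ℂ) • M)
      = (Complex.exp (μ * t) • 1) * NormedSpace.exp ((t : ℂ) • (M - μ • 1)) :=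
    ((congrArg NormedSpace.exp hs).trans (Matrix.exp_add_of_commute _ _ hc)).trans
      (congrArg (· * NormedSpace.exp ((t : ℂ) • (M - μ • 1))) h1)
  rw [hexp, ← Matrix.mulVec_mulVec, hfin, Matrix.smul_mulVec,
    Matrix.one_mulVec, Finset.smul_sum]
  refine Finset.sum_congr rfl fun k _ => ?_
  rw [smul_pow, Matrix.smul_mulVec, Matrix.smul_mulVec, smul_smul, smul_smul]
  congr 1; ring

theorem integrableOn_exp_entry {n : ℕ} (A : Matrix (Fin n) (Fin n) ℝ)
    (hA : ∀ μ : ℂ, Module.End.HasEigenvalue (Matrix.toLin' (A.map ((↑) : ℝ → ℂ))) μ → μ.re < 0)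
    (i j : Fin n) :
    IntegrableOn (fun t : ℝ => NormedSpace.exp (t • A) i j) (Ioi 0) := by
  let : NormedRing (Matrix (Fin n) (Fin n) ℝ) := Matrix.linftyOpNormedRing
  let : NormedAlgebra ℝ (Matrix (Fin n) (Fin n) ℝ) := Matrix.linftyOpNormedAlgebra
  let : NormedAlgebra ℚ (Matrix (Fin n) (Fin n) ℝ) := Matrix.linftyOpNormedAlgebra
  let : NormedRing (Matrix (Fin n) (Fin n) ℂ) := Matrix.linftyOpNormedRing
  let : NormedAlgebra ℂ (Matrix (Fin n) (Fin n) ℂ) := Matrix.linftyOpNormedAlgebra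
  let : NormedAlgebra ℚ (Matrix (Fin n) (Fin n) ℂ) := Matrix.linftyOpNormedAlgebra
  set M : Matrix (Fin n) (Fin n) ℂ := A.map ((↑) : ℝ → ℂ) with hM
  have hmap : ∀ t : ℝ, (NormedSpace.exp (t • A)).map ((↑) : ℝ → ℂ)
      = NormedSpace.exp ((t : ℂ) • M) := by
    intro t
    have h := NormedSpace.map_exp (Complex.ofRealHom.mapMatrix : Matrix (Fin n) (Fin n) ℝ →+* _)
      (by
        show Continuous fun X : Matrix (Fin n) (Fin n) ℝ => X.map ((↑) : ℝ → ℂ)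
        exact continuous_id.matrix_map Complex.continuous_ofReal) (t • A)
    have e : (Complex.ofRealHom.mapMatrix : Matrix (Fin n) (Fin n) ℝ →+* _) (t • A)
        = (t : ℂ) • M := by
      ext a b; simp [hM]
    rw [e] at h
    exact h
  let S : Submodule ℂ (Fin n → ℂ) :=
    { carrier := {v | ∀ a, IntegrableOn (fun t : ℝ => (NormedSpace.exp ((t : ℂ) • M) *ᵥ v) a)
        (Ioi 0)}
      add_mem' := by
        intro v w hv hw a
        simp only [Matrix.mulVec_add, Pi.add_apply]
        exact (hv a).add (hw a)
      zero_mem' := by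
        intro a
        simp only [Matrix.mulVec_zero, Pi.zero_apply]
        exact integrableOn_zero
      smul_mem' := by
        intro c v hv a
        simp only [Matrix.mulVec_smul, Pi.smul_apply]
        exact (hv a).smul c }
  have hS : S = ⊤ := by
    rw [eq_top_iff, ← Module.End.iSup_maxGenEigenspace_eq_top (Matrix.toLin' M)]
    refine iSup_le fun μ => ?_
    by_cases hμ : Module.End.maxGenEigenspace (Matrix.toLin' M) μ = ⊥
    · rw [hμ]; exact bot_le
    have hev : Module.End.HasEigenvalue (Matrix.toLin' M) μ := by
      by_contra hne
      apply hμ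
      rw [Submodule.eq_bot_iff]
      intro v hv
      obtain ⟨K, hK⟩ := (Module.End.mem_maxGenEigenspace _ _ _).1 hv
      have hinj : Function.Injective (Matrix.toLin' M - μ • (1 : Module.End ℂ (Fin n → ℂ))) := by
        rw [← LinearMap.ker_eq_bot]
        by_contra hk
        apply hne
        rw [Module.End.hasEigenvalue_iff, Module.End.eigenspace_def]
        simpa [Algebra.algebraMap_eq_smul_one] using hk
      have : Function.Injective ((Matrix.toLin' M - μ • (1 : Module.End ℂ (Fin n → ℂ))) ^ K) := by
        rw [Module.End.coe_pow]; exact hinj.iterate K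
      exact this (by rw [hK, map_zero])
    have hre := hA μ hev
    intro v hv
    obtain ⟨K, hK⟩ := (Module.End.mem_maxGenEigenspace _ _ _).1 hv
    intro a
    simp only [exp_smul_mulVec_of_mem_genEigenspace M μ v K hK, Finset.sum_apply, Pi.smul_apply,
      smul_eq_mul]
    refine integrable_finsetSum _ fun k _ => ?_
    refine Integrable.mul_const (Integrable.mul_const ?_ _) _
    refine (integrableOn_pow_mul_exp k hre).mono' (by fun_prop) ?_
    filter_upwards [ae_restrict_mem measurableSet_Ioi] with t ht
    have ht' : (0 : ℝ) < t := ht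
    rw [norm_mul, norm_pow, Complex.norm_real, Complex.norm_exp, Real.norm_eq_abs, abs_of_pos ht']
    simp
  have hmem : (Pi.single j 1 : Fin n → ℂ) ∈ S := hS ▸ Submodule.mem_top
  have h := (hmem i).re
  refine h.congr (Filter.Eventually.of_forall fun t => ?_)
  have e := congrFun (congrFun (hmap t) i) j
  simp only [Matrix.map_apply] at e
  change Complex.re ((NormedSpace.exp ((t : ℂ) • M) *ᵥ Pi.single j 1) i) = _
  rw [Matrix.mulVec_single_one, Matrix.col_apply, ← e, Complex.ofReal_re]

theorem conv_sq_le (k u : ℝ → ℝ≥0∞) (hk : Measurable k) (hu : Measurable u) (t : ℝ) :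
    (∫⁻ s, k (t - s) * u s) ^ (2 : ℝ) ≤ (∫⁻ s, k s) * ∫⁻ s, k (t - s) * u s ^ (2 : ℝ) := by
  have h := ENNReal.lintegral_mul_le_Lp_mul_Lq volume (p := 2) (q := 2)
    (Real.HolderConjugate.two_two)
    (f := fun s => k (t - s) ^ (1 / 2 : ℝ)) (g := fun s => k (t - s) ^ (1 / 2 : ℝ) * u s)
    (by fun_prop) (by fun_prop)
  have e1 : ∀ s, k (t - s) ^ (1 / 2 : ℝ) * (k (t - s) ^ (1 / 2 : ℝ) * u s) = k (t - s) * u s := by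
    intro s
    rw [← mul_assoc, ← ENNReal.rpow_add_of_nonneg _ _ (by norm_num) (by norm_num)]
    norm_num
  have e2 : ∀ s, (k (t - s) ^ (1 / 2 : ℝ) * u s) ^ (2 : ℝ) = k (t - s) * u s ^ (2 : ℝ) := by
    intro s
    rw [ENNReal.mul_rpow_of_nonneg _ _ (by norm_num), ← ENNReal.rpow_mul]
    norm_num
  have e3 : ∀ s, (k (t - s) ^ (1 / 2 : ℝ)) ^ (2 : ℝ) = k (t - s) := by
    intro s
    rw [← ENNReal.rpow_mul]; norm_num
  simp only [Pi.mul_apply, e1, e2, e3] at h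
  have h2 := ENNReal.rpow_le_rpow h (z := 2) (by norm_num)
  rw [ENNReal.mul_rpow_of_nonneg _ _ (by norm_num), ← ENNReal.rpow_mul, ← ENNReal.rpow_mul] at h2
  norm_num at h2
  rw [lintegral_sub_left_eq_self k t] at h2
  simpa using h2

theorem lintegral_conv_sq_le (k u : ℝ → ℝ≥0∞) (hk : Measurable k) (hu : Measurable u) :
    ∫⁻ t, (∫⁻ s, k (t - s) * u s) ^ (2 : ℝ) ≤ (∫⁻ s, k s) ^ (2 : ℝ) * ∫⁻ s, u s ^ (2 : ℝ) := by
  calc ∫⁻ t, (∫⁻ s, k (t - s) * u s) ^ (2 : ℝ)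
      ≤ ∫⁻ t, (∫⁻ s, k s) * ∫⁻ s, k (t - s) * u s ^ (2 : ℝ) :=
        lintegral_mono fun t => conv_sq_le k u hk hu t
    _ = (∫⁻ s, k s) * ∫⁻ t, ∫⁻ s, k (t - s) * u s ^ (2 : ℝ) := by
        rw [lintegral_const_mul]
        exact Measurable.lintegral_prod_right' (f := fun x : ℝ × ℝ => k (x.1 - x.2) * u x.2 ^ (2 : ℝ))
          (by fun_prop)
    _ = (∫⁻ s, k s) * ∫⁻ s, ∫⁻ t, k (t - s) * u s ^ (2 : ℝ) := by
        rw [lintegral_lintegral_swap]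
        exact Measurable.aemeasurable (f := fun x : ℝ × ℝ => k (x.1 - x.2) * u x.2 ^ (2 : ℝ))
          (by fun_prop)
    _ = (∫⁻ s, k s) * ∫⁻ s, (∫⁻ t, k t) * u s ^ (2 : ℝ) := by
        congr 1
        refine lintegral_congr fun s => ?_
        rw [lintegral_mul_const _ (by fun_prop), lintegral_sub_right_eq_self k s]
    _ = (∫⁻ s, k s) ^ (2 : ℝ) * ∫⁻ s, u s ^ (2 : ℝ) := by
        rw [lintegral_const_mul _ (by fun_prop), ← mul_assoc]
        norm_num [pow_two]

/-- The half line `[0, ∞)` as a measure space of times. -/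
noncomputable abbrev timeMeasure : Measure ℝ := volume.restrict (Ici 0)

/-- The causal convolution `(k ∗ u)(t) = ∫₀ᵗ k(t - s) u(s) ds`. -/
noncomputable def causalConv (k u : ℝ → ℝ) (t : ℝ) : ℝ := ∫ s in Icc 0 t, k (t - s) * u s

theorem eLpNorm_causalConv_le (k u : ℝ → ℝ) (hk : StronglyMeasurable k) (hu : StronglyMeasurable u) :
    eLpNorm (causalConv k u) 2 timeMeasure
      ≤ (∫⁻ s in Ici 0, ‖k s‖ₑ) * eLpNorm u 2 timeMeasure := by
  have key := lintegral_conv_sq_le ((Ici 0).indicator fun s => ‖k s‖ₑ)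
    ((Ici 0).indicator fun s => ‖u s‖ₑ)
    ((hk.enorm).indicator measurableSet_Ici) ((hu.enorm).indicator measurableSet_Ici)
  have hpt : ∀ t, ‖causalConv k u t‖ₑ ≤ ∫⁻ s, (Ici 0).indicator (fun s => ‖k s‖ₑ) (t - s)
      * (Ici 0).indicator (fun s => ‖u s‖ₑ) s := by
    intro t
    refine (enorm_integral_le_lintegral_enorm _).trans ?_
    rw [← lintegral_indicator measurableSet_Icc]
    refine lintegral_mono fun s => ?_
    by_cases hs : s ∈ Icc 0 t
    · have h1 : t - s ∈ Ici (0 : ℝ) := sub_nonneg.2 hs.2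
      have h2 : s ∈ Ici (0 : ℝ) := hs.1
      simp [indicator_of_mem hs, indicator_of_mem h1, indicator_of_mem h2, enorm_mul]
    · simp [indicator_of_notMem hs]
  have hu2 : ∫⁻ s, (Ici 0).indicator (fun s => ‖u s‖ₑ) s ^ (2 : ℝ)
      = ∫⁻ s in Ici 0, ‖u s‖ₑ ^ (2 : ℝ) := by
    rw [← lintegral_indicator measurableSet_Ici]
    refine lintegral_congr fun s => ?_
    by_cases hs : s ∈ Ici (0 : ℝ)
    · simp [indicator_of_mem hs]
    · simp [indicator_of_notMem hs]
  rw [lintegral_indicator measurableSet_Ici, hu2] at key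
  have hl : ∫⁻ t in Ici 0, ‖causalConv k u t‖ₑ ^ (2 : ℝ)
      ≤ (∫⁻ s in Ici 0, ‖k s‖ₑ) ^ (2 : ℝ) * ∫⁻ s in Ici 0, ‖u s‖ₑ ^ (2 : ℝ) :=
    (setLIntegral_le_lintegral _ _).trans
      ((lintegral_mono fun t => ENNReal.rpow_le_rpow (hpt t) (by norm_num)).trans key)
  rw [eLpNorm_eq_lintegral_rpow_enorm_toReal (by norm_num) (by norm_num),
    eLpNorm_eq_lintegral_rpow_enorm_toReal (by norm_num) (by norm_num)]
  simp only [ENNReal.toReal_ofNat]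
  refine (ENNReal.rpow_le_rpow hl (by norm_num)).trans ?_
  rw [ENNReal.mul_rpow_of_nonneg _ _ (by norm_num), ← ENNReal.rpow_mul]
  norm_num

theorem stronglyMeasurable_causalConv (k u : ℝ → ℝ) (hk : StronglyMeasurable k)
    (hu : StronglyMeasurable u) : StronglyMeasurable (causalConv k u) := by
  have hset : MeasurableSet {x : ℝ × ℝ | x.2 ∈ Icc 0 x.1} :=
    (measurableSet_le measurable_const measurable_snd).inter
      (measurableSet_le measurable_snd measurable_fst)
  have h : StronglyMeasurable fun x : ℝ × ℝ =>
      {x : ℝ × ℝ | x.2 ∈ Icc 0 x.1}.indicator (fun x => k (x.1 - x.2) * u x.2) x := by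
    refine StronglyMeasurable.indicator ?_ hset
    exact (hk.comp_measurable (measurable_fst.sub measurable_snd)).mul
      (hu.comp_measurable measurable_snd)
  have h2 := StronglyMeasurable.integral_prod_right' (ν := volume) h
  convert h2 using 2 with t
  rw [causalConv, ← integral_indicator measurableSet_Icc]
  rfl

theorem memLp_causalConv (k u : ℝ → ℝ) (hk : StronglyMeasurable k)
    (hki : IntegrableOn k (Ioi 0)) (hu : StronglyMeasurable u) (hu2 : MemLp u 2 timeMeasure) :
    MemLp (causalConv k u) 2 timeMeasure := by
  refine ⟨(stronglyMeasurable_causalConv k u hk hu).aestronglyMeasurable, ?_⟩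
  refine (eLpNorm_causalConv_le k u hk hu).trans_lt (ENNReal.mul_lt_top ?_ hu2.2)
  exact ((integrableOn_Ici_iff_integrableOn_Ioi (by simp)).2 hki).2

/-! ### Stable rational transfer matrices and their operators on `L₂` -/

/-- The companion matrix of the monic polynomial `Q` (ones above the diagonal, the negated
coefficients of `Q` in the last row). -/
noncomputable def companionMatrix (Q : ℝ[X]) : Matrix (Fin Q.natDegree) (Fin Q.natDegree) ℝ :=
  Matrix.of fun i j =>
    if (i : ℕ) + 1 = Q.natDegree then -Q.coeff j else if (j : ℕ) = i + 1 then 1 else 0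

theorem eq_pow_mul_of_companionMatrix_eigenvector {Q : ℝ[X]} {μ : ℂ} {x : Fin Q.natDegree → ℂ}
    (hx : (companionMatrix Q).map ((↑) : ℝ → ℂ) *ᵥ x = μ • x) (h0 : 0 < Q.natDegree) :
    ∀ i : ℕ, ∀ hi : i < Q.natDegree, x ⟨i, hi⟩ = μ ^ i * x ⟨0, h0⟩ := by
  intro i
  induction i with
  | zero => intro hi; simp
  | succ i ih =>
    intro hi
    have h := congrFun hx ⟨i, by omega⟩
    have hne : ¬ (i + 1 = Q.natDegree) := by omega
    simp only [Matrix.mulVec, dotProduct, Matrix.map_apply, companionMatrix, Matrix.of_apply,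
      if_neg hne, Pi.smul_apply, smul_eq_mul] at h
    rw [Finset.sum_eq_single (⟨i + 1, hi⟩ : Fin Q.natDegree)] at h
    · simp only [if_true, Complex.ofReal_one, one_mul] at h
      rw [h, ih (by omega), pow_succ]; ring
    · intro b _ hb
      have : ¬ ((b : ℕ) = i + 1) := fun hb' => hb (Fin.ext hb')
      simp [this]
    · simp

theorem aeval_eq_zero_of_companionMatrix_hasEigenvalue {Q : ℝ[X]} (hQ : Q.Monic) {μ : ℂ}
    (h : Module.End.HasEigenvalue (Matrix.toLin' ((companionMatrix Q).map ((↑) : ℝ → ℂ))) μ) :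
    Polynomial.aeval μ Q = 0 := by
  obtain ⟨x, hx⟩ := h.exists_hasEigenvector
  have hMx : (companionMatrix Q).map ((↑) : ℝ → ℂ) *ᵥ x = μ • x := by
    simpa [Matrix.toLin'_apply] using hx.apply_eq_smul
  have h0 : 0 < Q.natDegree := by
    by_contra hn
    apply hx.2
    funext i
    exact absurd i.2 (by omega)
  have hpow := eq_pow_mul_of_companionMatrix_eigenvector hMx h0
  have hx0 : x ⟨0, h0⟩ ≠ 0 := by
    intro hz
    apply hx.2
    funext i
    rw [hpow i i.2, hz, mul_zero]; rfl
  have hl := congrFun hMx ⟨Q.natDegree - 1, by omega⟩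
  have he : Q.natDegree - 1 + 1 = Q.natDegree := by omega
  simp only [Matrix.mulVec, dotProduct, Matrix.map_apply, companionMatrix, Matrix.of_apply,
    if_pos he, Pi.smul_apply, smul_eq_mul] at hl
  rw [hpow (Q.natDegree - 1) (by omega), Finset.sum_congr rfl (fun j _ => by
    rw [show x j = μ ^ (j : ℕ) * x ⟨0, h0⟩ from hpow j j.2])] at hl
  have hs : (∑ j : Fin Q.natDegree, (Q.coeff j : ℂ) * μ ^ (j : ℕ)) + μ ^ Q.natDegree = 0 := by
    refine (mul_eq_zero.1 ?_).resolve_right hx0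
    have e : μ ^ Q.natDegree = μ * μ ^ (Q.natDegree - 1) := by
      rw [← pow_succ', he]
    rw [add_mul, e, mul_assoc, ← hl, Finset.sum_mul, ← Finset.sum_add_distrib]
    refine Finset.sum_eq_zero fun j _ => ?_
    push_cast; ring
  rw [Polynomial.aeval_eq_sum_range, Finset.sum_range_succ, hQ.coeff_natDegree, ← hs,
    Finset.sum_range]
  simp [Algebra.smul_def]

/-- A real rational function that is proper and all of whose poles have negative real part. -/
def IsProperStable (f : RatFunc ℝ) : Prop :=
  f.num.natDegree ≤ f.denom.natDegree ∧ ∀ s : ℂ, Polynomial.aeval s f.denom = 0 → s.re < 0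

/-- `RH∞`: matrices of proper and stable real rational transfer functions. -/
structure RHInfty (κ ι : Type) where
  /-- the transfer matrix -/
  tf : Matrix κ ι (RatFunc ℝ)
  properStable : ∀ i j, IsProperStable (tf i j)

/-- A block of a transfer matrix. -/
def RHInfty.block {κ ι κ' ι' : Type} (G : RHInfty κ ι) (r : κ' → κ) (c : ι' → ι) :
    RHInfty κ' ι' where
  tf := G.tf.submatrix r c
  properStable i j := G.properStable (r i) (c j)

/-- The value `f(∞)` of a proper rational function (its denominator is monic). -/
noncomputable def feedthrough (f : RatFunc ℝ) : ℝ := f.num.coeff f.denom.natDegree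

/-- The numerator of the strictly proper part `f - f(∞)`, over the denominator of `f`. -/
noncomputable def strictNum (f : RatFunc ℝ) : ℝ[X] :=
  f.num - Polynomial.C (feedthrough f) * f.denom

/-- The input vector `(0, …, 0, 1)` of the controllable canonical form. -/
def inputVec (n : ℕ) : Fin n → ℝ := fun i => if (i : ℕ) + 1 = n then 1 else 0

/-- The output vector of the controllable canonical form: the coefficients of the numerator of the
strictly proper part. -/
noncomputable def outputVec (f : RatFunc ℝ) : Fin f.denom.natDegree → ℝ :=
  fun i => (strictNum f).coeff i

/-- The controllable canonical form is a realization of `f`: off the poles of `f`, the vector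
`x = (sⁱ)ᵢ / Q(s)` solves `(s - A) x = b`, and `c x + f(∞) = f(s)`. -/
theorem canonicalForm_realizes (f : RatFunc ℝ) (hf : f.num.natDegree ≤ f.denom.natDegree) (s : ℂ)
    (hs : Polynomial.aeval s f.denom ≠ 0) :
    ∃ x : Fin f.denom.natDegree → ℂ,
      (s • 1 - (companionMatrix f.denom).map ((↑) : ℝ → ℂ)) *ᵥ x
        = (fun i => (inputVec f.denom.natDegree i : ℂ)) ∧
      (fun i => (outputVec f i : ℂ)) ⬝ᵥ x + feedthrough f
        = Polynomial.aeval s f.num / Polynomial.aeval s f.denom := by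
  have hQ : f.denom.Monic := RatFunc.monic_denom f
  have hQs : Polynomial.aeval s f.denom = (∑ j : Fin f.denom.natDegree, (f.denom.coeff j : ℂ) * s ^ (j : ℕ)) 
      + s ^ f.denom.natDegree := by
    rw [Polynomial.aeval_eq_sum_range, Finset.sum_range_succ, hQ.coeff_natDegree, Finset.sum_range]
    simp [Algebra.smul_def]
  refine ⟨fun i => s ^ (i : ℕ) / Polynomial.aeval s f.denom, ?_, ?_⟩
  · funext i
    rw [Matrix.sub_mulVec, Matrix.smul_mulVec, Matrix.one_mulVec]
    simp only [Pi.sub_apply, Pi.smul_apply, smul_eq_mul, Matrix.mulVec, dotProduct,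
      Matrix.map_apply, companionMatrix, Matrix.of_apply, inputVec]
    by_cases hi : (i : ℕ) + 1 = f.denom.natDegree
    · simp only [hi, if_true]
      have e : ∑ j : Fin f.denom.natDegree, ((-f.denom.coeff j : ℝ) : ℂ) * (s ^ (j : ℕ) / Polynomial.aeval s f.denom)
          = -(∑ j : Fin f.denom.natDegree, (f.denom.coeff j : ℂ) * s ^ (j : ℕ)) / Polynomial.aeval s f.denom := by
        rw [neg_div, Finset.sum_div, ← Finset.sum_neg_distrib]
        refine Finset.sum_congr rfl fun j _ => ?_
        push_cast; ring
      rw [e, ← mul_div_assoc, ← pow_succ', hi, ← sub_div, sub_neg_eq_add, add_comm, ← hQs,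
        div_self hs]
      simp
    · have hlt : (i : ℕ) + 1 < f.denom.natDegree := by have := i.2; omega
      simp only [if_neg hi]
      rw [Finset.sum_eq_single (⟨i + 1, hlt⟩ : Fin f.denom.natDegree)]
      · simp only [if_true, Complex.ofReal_one, one_mul, pow_succ, Complex.ofReal_zero]
        ring
      · intro b _ hb
        have : ¬ ((b : ℕ) = i + 1) := fun hb' => hb (Fin.ext hb')
        simp [this]
      · simp
  · have hcoef : (strictNum f).coeff f.denom.natDegree = 0 := by
      simp [strictNum, feedthrough, hQ.coeff_natDegree]
    have hdeg : (strictNum f).natDegree ≤ f.denom.natDegree :=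
      (Polynomial.natDegree_sub_le _ _).trans
        (max_le hf ((Polynomial.natDegree_C_mul_le _ _)))
    have hN : Polynomial.aeval s (strictNum f) 
        = ∑ j : Fin f.denom.natDegree, ((strictNum f).coeff j : ℂ) * s ^ (j : ℕ) := by
      rw [Polynomial.aeval_eq_sum_range' (n := f.denom.natDegree + 1) (by omega), Finset.sum_range_succ, hcoef,
        Finset.sum_range]
      simp [Algebra.smul_def]
    have e : (fun i => (outputVec f i : ℂ)) ⬝ᵥ (fun i => s ^ (i : ℕ) / Polynomial.aeval s f.denom)
        = Polynomial.aeval s (strictNum f) / Polynomial.aeval s f.denom := by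
      rw [hN, Finset.sum_div]
      simp only [dotProduct, outputVec]
      refine Finset.sum_congr rfl fun j _ => ?_
      ring
    rw [e, strictNum]
    simp only [map_sub, map_mul, Polynomial.aeval_C]
    rw [sub_div, mul_div_assoc, div_self hs]
    simp [Algebra.algebraMap_eq_smul_one]

/-- The impulse response `t ↦ c exp(t A) b` of the strictly proper part of `f`. -/
noncomputable def impulseResponse (f : RatFunc ℝ) (t : ℝ) : ℝ :=
  outputVec f ⬝ᵥ (NormedSpace.exp (t • companionMatrix f.denom) *ᵥ inputVec f.denom.natDegree)

theorem stronglyMeasurable_impulseResponse (f : RatFunc ℝ) :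
    StronglyMeasurable (impulseResponse f) := by
  refine Continuous.stronglyMeasurable ?_
  unfold impulseResponse dotProduct Matrix.mulVec dotProduct
  exact continuous_finsetSum _ fun i _ => continuous_const.mul
    (continuous_finsetSum _ fun j _ => (continuous_exp_smul_entry _ i j).mul continuous_const)

theorem integrableOn_impulseResponse {f : RatFunc ℝ} (hf : IsProperStable f) :
    IntegrableOn (impulseResponse f) (Ioi 0) := by
  unfold impulseResponse dotProduct Matrix.mulVec dotProduct
  refine integrable_finsetSum _ fun i _ => Integrable.const_mul ?_ _
  refine integrable_finsetSum _ fun j _ => Integrable.mul_const ?_ _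
  exact integrableOn_exp_entry _ (fun μ hμ => hf.2 μ
    (aeval_eq_zero_of_companionMatrix_hasEigenvalue (RatFunc.monic_denom f) hμ)) i j

/-- `L₂^d = L₂([0, ∞), ℝ^d)`, with the Euclidean inner product on `ℝ^d`. -/
abbrev L2 (d : ℕ) : Type := Lp (EuclideanSpace ℝ (Fin d)) 2 timeMeasure

/-- The output `y = G u` in the time domain: `y_i = Σ_j (G_ij(∞) u_j + g_ij ∗ u_j)`, where `g_ij` is
the impulse response of the strictly proper part of `G_ij`. -/
noncomputable def RHInfty.response {p q : ℕ} (G : RHInfty (Fin q) (Fin p))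
    (u : ℝ → EuclideanSpace ℝ (Fin p)) (t : ℝ) : EuclideanSpace ℝ (Fin q) :=
  WithLp.toLp 2 fun i => ∑ j, (feedthrough (G.tf i j) * u t j
    + causalConv (impulseResponse (G.tf i j)) (fun s => u s j) t)

theorem RHInfty.memLp_response {p q : ℕ} (G : RHInfty (Fin q) (Fin p)) (u : L2 p) :
    MemLp (G.response u) 2 timeMeasure := by
  have hu : ∀ j, StronglyMeasurable fun s => u s j := fun j =>
    (EuclideanSpace.proj (𝕜 := ℝ) j).continuous.comp_stronglyMeasurable (Lp.stronglyMeasurable u)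
  have hu2 : ∀ j, MemLp (fun s => u s j) 2 timeMeasure := fun j =>
    (EuclideanSpace.proj (𝕜 := ℝ) j).comp_memLp' (Lp.memLp u)
  refine MemLp.of_eval_piLp fun i => ?_
  refine memLp_finsetSum (μ := timeMeasure) (f := fun j t => feedthrough (G.tf i j) * u t j
    + causalConv (impulseResponse (G.tf i j)) (fun s => u s j) t) Finset.univ fun j _ => ?_
  exact ((hu2 j).const_mul _).add (memLp_causalConv _ _ (stronglyMeasurable_impulseResponse _)
    (integrableOn_impulseResponse (G.properStable i j)) (hu j) (hu2 j))

/-- The causal operator `L₂^p → L₂^q` with transfer matrix `G`. -/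
noncomputable def RHInfty.op {p q : ℕ} (G : RHInfty (Fin q) (Fin p)) (u : L2 p) : L2 q :=
  (G.memLp_response u).toLp

/-! ### Truncation, causality, extended spaces -/

/-- The truncation `P_T` on `L₂^d`. -/
noncomputable def trunc {d : ℕ} (T : ℝ≥0) (u : L2 d) : L2 d :=
  ((Lp.memLp u).indicator (measurableSet_Iic (a := (T : ℝ)))).toLp

/-- `R` is causal on `L₂^p`: `P_T R u = P_T R P_T u`. -/
def IsCausal {p q : ℕ} (R : L2 p → L2 q) : Prop :=
  ∀ (u : L2 p) (T : ℝ≥0), trunc T (R u) = trunc T (R (trunc T u))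

/-- The extended space `L₂ₑ^d`: (classes of) signals all of whose truncations are in `L₂^d`. -/
def L2e (d : ℕ) : Type :=
  {f : ℝ →ₘ[timeMeasure] EuclideanSpace ℝ (Fin d) //
    ∀ T : ℝ≥0, MemLp ((Iic (T : ℝ)).indicator f) 2 timeMeasure}

/-- The truncation `P_T : L₂ₑ^d → L₂^d`. -/
noncomputable def L2e.trunc {d : ℕ} (T : ℝ≥0) (f : L2e d) : L2 d := (f.2 T).toLp

/-- `y = H e` for the extension of a causal `H : L₂^p → L₂^q` to `L₂ₑ^p → L₂ₑ^q`, which is given by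
`P_T H e = P_T H P_T e` for all `T`. -/
def ExtendedEq {p q : ℕ} (H : L2 p → L2 q) (e : L2e p) (y : L2e q) : Prop :=
  ∀ T : ℝ≥0, y.trunc T = trunc T (H (e.trunc T))

/-! ### Incremental gain, relations, feedback interconnections -/

/-- The incremental gain `Γ(R) ∈ [0, ∞]`. -/
noncomputable def incGain {p q : ℕ} (R : L2 p → L2 q) : ℝ≥0∞ :=
  ⨆ (x₁ : L2 p) (x₂ : L2 p) (_ : x₁ ≠ x₂), ‖R x₁ - R x₂‖ₑ / ‖x₁ - x₂‖ₑ

/-- The sum `R + S = {(x, y + z) | (x, y) ∈ R, (x, z) ∈ S}` of relations. -/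
def relSum {X Y : Type*} [Add Y] (R S : SetRel X Y) : SetRel X Y :=
  {a | ∃ y z, (a.1, y) ∈ R ∧ (a.1, z) ∈ S ∧ a.2 = y + z}

/-- The interconnection `[H₁, H₂]` (that is, `e = u - H₂ y`, `y = H₁ e`) is well-posed on `L₂`. -/
def WellPosed {p q : ℕ} (H₁ : L2 p → L2 q) (H₂ : L2 q → L2 p) : Prop :=
  ∀ u : L2 p, ∃! s : L2 p × L2 q, s.1 = u - H₂ s.2 ∧ s.2 = H₁ s.1

/-- The interconnection `[H₁, H₂]` of causal operators is well-posed in the extended spaces: for all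
`u ∈ L₂^p` there are unique `e ∈ L₂ₑ^p`, `y ∈ L₂ₑ^q` with `e = u - H₂ y` and `y = H₁ e`. -/
def WellPosedExtended {p q : ℕ} (H₁ : L2 p → L2 q) (H₂ : L2 q → L2 p) : Prop :=
  ∀ u : L2 p, ∃! s : L2e p × L2e q,
    (∃ v : L2e p, ExtendedEq H₂ s.2 v ∧
      s.1.1 = (u : ℝ →ₘ[timeMeasure] EuclideanSpace ℝ (Fin p)) - v.1) ∧
    ExtendedEq H₁ s.1 s.2

/-! ### Scaled relative graphs -/

/-- The scaled relative graph of an operator `R` on a real Hilbert space over the inputs `U`. (For a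
single-valued `R` it does not contain `∞`. If `R u₁ = R u₂`, the modulus is `0`.) -/
noncomputable def srgOn {H : Type*} [NormedAddCommGroup H] [InnerProductSpace ℝ H]
    (R : H → H) (U : Set H) : Set (OnePoint ℂ) :=
  {z | ∃ u₁ ∈ U, ∃ u₂ ∈ U, u₁ ≠ u₂ ∧ ∃ σ : ℝ, (σ = 1 ∨ σ = -1) ∧
    z = (((‖R u₁ - R u₂‖ / ‖u₁ - u₂‖ : ℝ) : ℂ) * Complex.exp
      ((σ * InnerProductGeometry.angle (u₁ - u₂) (R u₁ - R u₂) : ℝ) * Complex.I) : ℂ)}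

/-- `ℝ^m → ℝ^n`: append zeros if `m ≤ n`, drop the last coordinates if `n ≤ m`. -/
noncomputable def resizeVec (m n : ℕ) :
    EuclideanSpace ℝ (Fin m) →L[ℝ] EuclideanSpace ℝ (Fin n) :=
  LinearMap.toContinuousLinearMap
    { toFun := fun x => WithLp.toLp 2 fun i : Fin n => if h : (i : ℕ) < m then x ⟨i, h⟩ else 0
      map_add' := by
        intro x y
        ext i
        by_cases h : (i : ℕ) < m <;> simp [h]
      map_smul' := by
        intro c x
        ext i
        by_cases h : (i : ℕ) < m <;> simp [h] }

/-- `L₂^m → L₂^n`: the embedding `ι_{n ← m}` if `m ≤ n`, the projection `π_{n ← m}` if `n ≤ m`. -/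
noncomputable def resize (m n : ℕ) : L2 m →L[ℝ] L2 n := (resizeVec m n).compLpL 2 timeMeasure

/-- The SRG of a possibly non-square `R : L₂^p → L₂^q`: the SRG of `ι_{n ← q} R π_{p ← n}` over
`ι_{n ← p}(L₂^p)`, where `n = max p q`. -/
noncomputable def mimoSRG {p q : ℕ} (R : L2 p → L2 q) : Set (OnePoint ℂ) :=
  srgOn (fun x => resize q (max p q) (R (resize (max p q) p x))) (range (resize p (max p q)))

/-! ### Arithmetic of subsets of the extended complex plane -/

/-- Addition on `ℂ ∪ {∞}`, with `∞ + z = z + ∞ = ∞ + ∞ = ∞`. -/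
noncomputable def extAdd : OnePoint ℂ → OnePoint ℂ → OnePoint ℂ
  | OnePoint.some z, OnePoint.some w => ((z + w : ℂ) : OnePoint ℂ)
  | _, _ => OnePoint.infty

/-- Multiplication on `ℂ ∪ {∞}`, with `∞ · z = z · ∞ = ∞ · ∞ = ∞`, also for `z = 0`. -/
noncomputable def extMul : OnePoint ℂ → OnePoint ℂ → OnePoint ℂ
  | OnePoint.some z, OnePoint.some w => ((z * w : ℂ) : OnePoint ℂ)
  | _, _ => OnePoint.infty

open Classical in
/-- The inversion `r e^{iφ} ↦ r⁻¹ e^{iφ}`, exchanging `0` and `∞`. -/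
noncomputable def extInv : OnePoint ℂ → OnePoint ℂ
  | OnePoint.some z => if z = 0 then OnePoint.infty else (((starRingEnd ℂ z)⁻¹ : ℂ) : OnePoint ℂ)
  | OnePoint.infty => ((0 : ℂ) : OnePoint ℂ)

/-- `C₁ + C₂` -/
def setAdd (C₁ C₂ : Set (OnePoint ℂ)) : Set (OnePoint ℂ) := image2 extAdd C₁ C₂

/-- `C₁ C₂` -/
def setMul (C₁ C₂ : Set (OnePoint ℂ)) : Set (OnePoint ℂ) := image2 extMul C₁ C₂

/-- `C⁻¹` -/
def setInv (C : Set (OnePoint ℂ)) : Set (OnePoint ℂ) := extInv '' C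

/-- `α C` for a real `α` -/
def setScale (α : ℝ) (C : Set (OnePoint ℂ)) : Set (OnePoint ℂ) :=
  extMul (((α : ℂ)) : OnePoint ℂ) '' C

/-- The chord `[z, z̄]`. -/
def chord (z : ℂ) : Set ℂ := segment ℝ z (starRingEnd ℂ z)

/-- The right-hand arc `{r e^{i(1 - 2α)φ} | z = r e^{iφ}, φ ∈ (-π, π], α ∈ [0, 1]}`. -/
def rightArc (z : ℂ) : Set ℂ :=
  {w | ∃ α ∈ Icc (0 : ℝ) 1,
    w = (‖z‖ : ℂ) * Complex.exp (((1 - 2 * α) * Complex.arg z : ℝ) * Complex.I)}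

/-- The left-hand arc `Arc⁻(z, z̄) = -Arc⁺(-z, -z̄)`. -/
def leftArc (z : ℂ) : Set ℂ := {w | -w ∈ rightArc (-z)}

/-- The completion `⋃_{z ∈ C} S(z)` of a subset of `ℂ ∪ {∞}`; the point `∞` is left alone. -/
def completion (S : ℂ → Set ℂ) (C : Set (OnePoint ℂ)) : Set (OnePoint ℂ) :=
  {w | (∃ z : ℂ, (z : OnePoint ℂ) ∈ C ∧ ∃ v ∈ S z, w = (v : OnePoint ℂ)) ∨
    (w = OnePoint.infty ∧ OnePoint.infty ∈ C)}

/-- The improved chord completion of a sum. -/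
def improvedAdd (C₁ C₂ : Set (OnePoint ℂ)) : Set (OnePoint ℂ) :=
  setAdd (completion chord C₁) C₂ ∩ setAdd C₁ (completion chord C₂)

/-- The improved arc completion of a product. -/
def improvedMul (C₁ C₂ : Set (OnePoint ℂ)) : Set (OnePoint ℂ) :=
  setMul (completion rightArc C₁) C₂ ∩ setMul C₁ (completion rightArc C₂) ∩
    setMul (completion leftArc C₁) C₂ ∩ setMul C₁ (completion leftArc C₂)

/-- The radius `inf {r > 0 | C ⊆ D_r(0)} ∈ [0, ∞]`; it is `∞` if `C` is unbounded or `∞ ∈ C`. -/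
noncomputable def radius (C : Set (OnePoint ℂ)) : ℝ≥0∞ :=
  ⨅ (r : ℝ≥0) (_ : 0 < r)
    (_ : C ⊆ ((↑) : ℂ → OnePoint ℂ) '' Metric.closedBall (0 : ℂ) r), (r : ℝ≥0∞)

/-! ### Systems in LFR form -/

section LFR

variable {nz nw p q : ℕ}

/-- The transfer matrix `G`, with output channels `(z, y)` and input channels `(w, u)`. -/
abbrev LFRPlant (nz nw p q : ℕ) : Type := RHInfty (Fin nz ⊕ Fin q) (Fin nw ⊕ Fin p)

/-- `G_zw : L₂^{n_w} → L₂^{n_z}` -/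
noncomputable def LFRPlant.zw (G : LFRPlant nz nw p q) : L2 nw → L2 nz :=
  (RHInfty.block G Sum.inl Sum.inl).op

/-- `G_zu : L₂^p → L₂^{n_z}` -/
noncomputable def LFRPlant.zu (G : LFRPlant nz nw p q) : L2 p → L2 nz :=
  (RHInfty.block G Sum.inl Sum.inr).op

/-- `G_yw : L₂^{n_w} → L₂^q` -/
noncomputable def LFRPlant.yw (G : LFRPlant nz nw p q) : L2 nw → L2 q :=
  (RHInfty.block G Sum.inr Sum.inl).op

/-- `G_yu : L₂^p → L₂^q` -/
noncomputable def LFRPlant.yu (G : LFRPlant nz nw p q) : L2 p → L2 q :=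
  (RHInfty.block G Sum.inr Sum.inr).op

open SetRel Function in
/-- The closed loop `R = G_yw (Φ⁻¹ - G_zw)⁻¹ G_zu + G_yu`, as a relation. -/
def lfrRelation (G : LFRPlant nz nw p q) (Φ : L2 nz → L2 nw) : SetRel (L2 p) (L2 q) :=
  relSum
    ((graph (LFRPlant.zu G)).comp
      ((relSum (graph Φ).inv (graph fun w => -LFRPlant.zw G w)).inv.comp (graph (LFRPlant.yw G))))
    (graph (LFRPlant.yu G))

/-- The SRG bound `SRG(G_yu) + SRG(G_yw) (SRG(Φ)⁻¹ - τ SRG(G_zw))⁻¹ SRG(G_zu)`, where every sum and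
every product is replaced by its improved chord or arc completion. -/
noncomputable def lfrSRGBound (G : LFRPlant nz nw p q) (Φ : L2 nz → L2 nw) (τ : ℝ) :
    Set (OnePoint ℂ) :=
  improvedAdd (mimoSRG (LFRPlant.yu G))
    (improvedMul
      (improvedMul (mimoSRG (LFRPlant.yw G))
        (setInv (improvedAdd (setInv (mimoSRG Φ)) (setScale (-τ) (mimoSRG (LFRPlant.zw G))))))
      (mimoSRG (LFRPlant.zu G)))

end LFR

/-! ### Truncation and extended signals -/

/-! The relation `Φ⁻¹ - τ G_zw` is parametrised by the input `e` of `Φ`: it sends `w = Φ e` to `v =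
e - τ G_zw Φ e`, the value of `loopMap`. Everything rests on how increments `Δe`, `Δw`, `Δv`
contribute points to SRGs. For sums, the components along the input add, and the orthogonal ones
obey the triangle inequality, which is what the chord absorbs. For compositions, gains multiply and
angles obey the triangle inequality on the sphere, which is what the two arcs absorb
(`CoversPair.improvedAdd`, `CoversPair.improvedMul`). So `(Δw, Δv)` contributes to `A_τ`, and `(Δv,
Δw)` to `A_τ⁻¹`.

If `G_yw` and `G_zu` are nonzero, fix `k` in the SRG of `G_yu` and nonzero `g`, `c` in those of
`G_yw`, `G_zu`. Each `a` in `A_τ⁻¹` puts `k + g a c` into a set of radius at most `Γ̂`; hence `a` is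
finite and bounded by a constant `M` that does not depend on `τ` (`exists_uniform_bound`). Thus
`‖Δw‖ ≤ M ‖Δv‖` and `‖Δe‖ ≤ (1 + ‖G_zw‖ M) ‖Δv‖` for all `τ ∈ [0, 1]`.

At `τ = 0` the loop map is the identity. The uniform estimate and `Γ(Φ) < ∞` let Banach's fixed
point theorem carry surjectivity from `τ` to `τ'` in steps of one fixed size, up to `τ = 1`
(`surjective_sub_of_uniform_bound`). The same continuation shows that truncated outputs determine
truncated inputs (`truncated_injective_of_uniform_bound`), i.e. that the inverse loop is causal;
this also gives uniqueness in the extended spaces. The gain bound is then the SRG inclusion at `τ =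
1` (`norm_lfr_sub_le`).

If `G_yw` or `G_zu` vanishes, its SRG contains `0`, so every `k` in the SRG of `G_yu` lies in the
bound, and a well-posed closed loop differs from `G_yu` only by a constant. -/

theorem trunc_coeFn {d : ℕ} (T : ℝ≥0) (u : L2 d) :
    trunc T u =ᵐ[timeMeasure] (Iic (T : ℝ)).indicator u :=
  MemLp.coeFn_toLp _

theorem trunc_eq_trunc_iff {d : ℕ} (T : ℝ≥0) (u v : L2 d) :
    trunc T u = trunc T v ↔ ∀ᵐ t ∂timeMeasure, t ≤ (T : ℝ) → u t = v t := by
  unfold trunc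
  rw [MemLp.toLp_eq_toLp_iff]
  refine ⟨fun h => ?_, fun h => ?_⟩
  · filter_upwards [h] with t ht htT
    simpa [indicator_of_mem (show t ∈ Iic (T : ℝ) from htT)] using ht
  · filter_upwards [h] with t ht
    by_cases htT : t ∈ Iic (T : ℝ)
    · simp [indicator_of_mem htT, ht htT]
    · simp [indicator_of_notMem htT]

theorem norm_trunc_le {d : ℕ} (T : ℝ≥0) (u : L2 d) : ‖trunc T u‖ ≤ ‖u‖ := by
  refine Lp.norm_le_norm_of_ae_le ?_
  filter_upwards [trunc_coeFn T u] with t ht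
  rw [ht]
  exact norm_indicator_le_norm_self _ _

/-- The truncation as a linear map. -/
noncomputable def truncL {d : ℕ} (T : ℝ≥0) : L2 d →ₗ[ℝ] L2 d where
  toFun := trunc T
  map_add' u v := by
    apply Lp.ext
    filter_upwards [trunc_coeFn T (u + v), trunc_coeFn T u, trunc_coeFn T v, Lp.coeFn_add u v,
      Lp.coeFn_add (trunc T u) (trunc T v)] with t h1 h2 h3 h4 h5
    rw [h1, h5, Pi.add_apply, h2, h3]
    by_cases ht : t ∈ Iic (T : ℝ)
    · simp only [indicator_of_mem ht, h4, Pi.add_apply]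
    · simp only [indicator_of_notMem ht, add_zero]
  map_smul' c u := by
    apply Lp.ext
    filter_upwards [trunc_coeFn T (c • u), trunc_coeFn T u, Lp.coeFn_smul c u,
      Lp.coeFn_smul c (trunc T u)] with t h1 h2 h3 h4
    simp only [RingHom.id_apply]
    rw [h1, h4, Pi.smul_apply, h2]
    by_cases ht : t ∈ Iic (T : ℝ)
    · simp only [indicator_of_mem ht, h3, Pi.smul_apply]
    · simp only [indicator_of_notMem ht, smul_zero]

@[simp] theorem truncL_apply {d : ℕ} (T : ℝ≥0) (u : L2 d) : truncL T u = trunc T u := rfl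

theorem trunc_trunc {d : ℕ} (T : ℝ≥0) (u : L2 d) : trunc T (trunc T u) = trunc T u := by
  rw [trunc_eq_trunc_iff]
  filter_upwards [trunc_coeFn T u] with t ht htT
  rw [ht, indicator_of_mem (show t ∈ Iic (T : ℝ) from htT)]

/-- A square integrable signal as an element of the extended space. -/
noncomputable def L2.toExtended {d : ℕ} (u : L2 d) : L2e d :=
  ⟨u.1, fun T => (Lp.memLp u).indicator (measurableSet_Iic (a := (T : ℝ)))⟩

@[simp] theorem L2.trunc_toExtended {d : ℕ} (T : ℝ≥0) (u : L2 d) :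
    u.toExtended.trunc T = trunc T u := rfl

theorem L2e.trunc_coeFn {d : ℕ} (T : ℝ≥0) (f : L2e d) :
    f.trunc T =ᵐ[timeMeasure] (Iic (T : ℝ)).indicator f.1 :=
  MemLp.coeFn_toLp _

/-- Integer horizons exhaust the half line, and being countable they leave only a null set of
exceptional times. -/
theorem L2e.ext_trunc {d : ℕ} {f g : L2e d} (h : ∀ T : ℝ≥0, f.trunc T = g.trunc T) : f = g := by
  refine Subtype.ext (AEEqFun.ext ?_)
  have h' : ∀ n : ℕ, ∀ᵐ t ∂timeMeasure, t ≤ (n : ℝ) → f.1 t = g.1 t := by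
    intro n
    filter_upwards [L2e.trunc_coeFn (n : ℝ≥0) f, L2e.trunc_coeFn (n : ℝ≥0) g] with t h1 h2 ht
    have hm : t ∈ Iic (((n : ℝ≥0) : ℝ)) := by simpa using ht
    rw [h n, h2, indicator_of_mem hm, indicator_of_mem hm] at h1
    exact h1.symm
  filter_upwards [ae_all_iff.2 h'] with t ht
  obtain ⟨n, hn⟩ := exists_nat_ge t
  exact ht n hn

theorem L2e.trunc_trunc {d : ℕ} (T : ℝ≥0) (f : L2e d) :
    _root_.trunc T (f.trunc T) = f.trunc T := by
  apply Lp.ext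
  filter_upwards [L2e.trunc_coeFn T f, _root_.trunc_coeFn T (f.trunc T)] with t h1 h2
  rw [h2]
  by_cases ht : t ∈ Iic (T : ℝ)
  · rw [indicator_of_mem ht]
  · rw [indicator_of_notMem ht, h1, indicator_of_notMem ht]

theorem L2e.trunc_eq_sub {d : ℕ} {f v : L2e d} {u : L2 d}
    (h : f.1 = (u : ℝ →ₘ[timeMeasure] EuclideanSpace ℝ (Fin d)) - v.1) (T : ℝ≥0) :
    f.trunc T = _root_.trunc T u - v.trunc T := by
  apply Lp.ext
  have h0 : (f.1 : ℝ → EuclideanSpace ℝ (Fin d)) =ᵐ[timeMeasure] (u : ℝ → _) - v.1 := by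
    rw [h]; exact AEEqFun.coeFn_sub _ _
  filter_upwards [L2e.trunc_coeFn T f, L2e.trunc_coeFn T v, _root_.trunc_coeFn T u, h0,
    Lp.coeFn_sub (_root_.trunc T u) (v.trunc T)] with t h1 h2 h3 h4 h5
  rw [h1, h5, Pi.sub_apply, h2, h3]
  by_cases ht : t ∈ Iic (T : ℝ)
  · simp only [indicator_of_mem ht, h4, Pi.sub_apply]
  · simp only [indicator_of_notMem ht, sub_zero]

/-- Supplies two distinct inputs, without which an SRG would be empty and the elementwise products
and sums would carry no information. -/
theorem nontrivial_L2 {d : ℕ} (hd : 0 < d) : ∃ u : L2 d, u ≠ 0 := by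
  have hμ : timeMeasure (Icc 0 1) = 1 := by
    rw [Measure.restrict_apply measurableSet_Icc,
      inter_eq_left.2 (Icc_subset_Ici_self : Icc (0 : ℝ) 1 ⊆ Ici 0)]
    simp
  refine ⟨indicatorConstLp 2 (measurableSet_Icc (a := (0 : ℝ)) (b := 1)) (by simp [hμ])
    (EuclideanSpace.single (⟨0, hd⟩ : Fin d) (1 : ℝ)), fun h => ?_⟩
  have h1 := congrArg norm h
  rw [norm_indicatorConstLp (by norm_num) (by norm_num), measureReal_def, hμ] at h1
  simp at h1

/-! ### The incremental gain -/

theorem norm_sub_le_incGain {p q : ℕ} {R : L2 p → L2 q} (hR : incGain R < ⊤) (x y : L2 p) :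
    ‖R x - R y‖ ≤ (incGain R).toReal * ‖x - y‖ := by
  rcases eq_or_ne x y with rfl | hxy
  · simp
  have h : ‖R x - R y‖ₑ / ‖x - y‖ₑ ≤ incGain R :=
    le_iSup_of_le x (le_iSup_of_le y (le_iSup_of_le hxy le_rfl))
  have h0 : ‖x - y‖ₑ ≠ 0 := by simpa [sub_eq_zero] using hxy
  have h' := ENNReal.toReal_mono (ENNReal.mul_ne_top hR.ne enorm_ne_top)
    ((ENNReal.div_le_iff h0 enorm_ne_top).1 h)
  simpa [ENNReal.toReal_mul] using h'

theorem incGain_le {p q : ℕ} {R : L2 p → L2 q} {Γ : ℝ≥0}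
    (h : ∀ x y, x ≠ y → ‖R x - R y‖ ≤ Γ * ‖x - y‖) : incGain R ≤ Γ := by
  refine iSup_le fun x => iSup_le fun y => iSup_le fun hxy => ?_
  have h0 : ‖x - y‖ₑ ≠ 0 := by simpa [sub_eq_zero] using hxy
  rw [ENNReal.div_le_iff h0 enorm_ne_top]
  have := h x y hxy
  simp only [enorm_eq_nnnorm]
  exact_mod_cast this

/-! ### Stable transfer matrices act as bounded causal linear operators -/

theorem continuous_impulseResponse (f : RatFunc ℝ) : Continuous (impulseResponse f) := by
  unfold impulseResponse dotProduct Matrix.mulVec dotProduct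
  exact continuous_finsetSum _ fun i _ => continuous_const.mul
    (continuous_finsetSum _ fun j _ => (continuous_exp_smul_entry _ i j).mul continuous_const)

theorem causalConv_congr (k : ℝ → ℝ) {u v : ℝ → ℝ} {t : ℝ}
    (h : ∀ᵐ s ∂timeMeasure, s ≤ t → u s = v s) : causalConv k u t = causalConv k v t := by
  refine integral_congr_ae ?_
  have h' := ae_restrict_of_ae_restrict_of_subset (Icc_subset_Ici_self : Icc 0 t ⊆ Ici 0) h
  filter_upwards [h', ae_restrict_mem measurableSet_Icc] with s hs hst
  rw [hs hst.2]

/-- On a bounded interval `L₂` lies in `L₁`, and the continuous kernel is bounded there. Additivity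
of the convolution needs this at every `t`, since a non-integrable integrand has integral `0` by
convention. -/
theorem integrableOn_causalConv {k u : ℝ → ℝ} (hk : Continuous k) (hu : MemLp u 2 timeMeasure)
    (t : ℝ) : IntegrableOn (fun s => k (t - s) * u s) (Icc 0 t) := by
  have h1 : MemLp u 2 (volume.restrict (Icc 0 t)) :=
    hu.mono_measure (Measure.restrict_mono Icc_subset_Ici_self le_rfl)
  have h2 : IntegrableOn u (Icc 0 t) := h1.integrable (by norm_num)
  exact h2.continuousOn_mul (Continuous.continuousOn (by fun_prop)) isCompact_Icc

theorem causalConv_add {k u v : ℝ → ℝ} (hk : Continuous k) (hu : MemLp u 2 timeMeasure)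
    (hv : MemLp v 2 timeMeasure) (t : ℝ) :
    causalConv k (fun s => u s + v s) t = causalConv k u t + causalConv k v t := by
  unfold causalConv
  rw [← integral_add (integrableOn_causalConv hk hu t) (integrableOn_causalConv hk hv t)]
  simp only [mul_add]

theorem causalConv_const_mul (k u : ℝ → ℝ) (c t : ℝ) :
    causalConv k (fun s => c * u s) t = c * causalConv k u t := by
  unfold causalConv
  rw [← integral_const_mul]
  refine integral_congr_ae (.of_forall fun s => ?_)
  ring

namespace RHInfty

variable {p q : ℕ} (G : RHInfty (Fin q) (Fin p))

/-- The feedthrough term sees the value at `t` itself, which agreement almost everywhere on the past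
does not control; hence two hypotheses. -/
theorem response_congr {u v : ℝ → EuclideanSpace ℝ (Fin p)} {t : ℝ} (ht : u t = v t)
    (h : ∀ᵐ s ∂timeMeasure, s ≤ t → u s = v s) : G.response u t = G.response v t := by
  unfold response
  congr 1
  funext i
  refine Finset.sum_congr rfl fun j _ => ?_
  rw [ht, causalConv_congr _ (h.mono fun s hs hst => congrArg (· j) (hs hst))]

theorem response_congr_ae {u v : ℝ → EuclideanSpace ℝ (Fin p)} (h : u =ᵐ[timeMeasure] v) :
    G.response u =ᵐ[timeMeasure] G.response v := by
  filter_upwards [h] with t ht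
  exact G.response_congr ht (h.mono fun s hs _ => hs)

theorem op_coeFn (u : L2 p) : G.op u =ᵐ[timeMeasure] G.response u := MemLp.coeFn_toLp _

theorem memLp_coord (u : L2 p) (j : Fin p) : MemLp (fun s => u s j) 2 timeMeasure :=
  (EuclideanSpace.proj (𝕜 := ℝ) j).comp_memLp' (Lp.memLp u)

theorem op_add (u v : L2 p) : G.op (u + v) = G.op u + G.op v := by
  apply Lp.ext
  filter_upwards [G.op_coeFn (u + v), G.op_coeFn u, G.op_coeFn v,
    Lp.coeFn_add (G.op u) (G.op v), G.response_congr_ae (Lp.coeFn_add u v)] with t h1 h2 h3 h4 h5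
  rw [h1, h4, Pi.add_apply, h2, h3, h5]
  ext i
  simp only [response, PiLp.add_apply, Pi.add_apply]
  rw [← Finset.sum_add_distrib]
  refine Finset.sum_congr rfl fun j _ => ?_
  rw [causalConv_add (continuous_impulseResponse _) (memLp_coord u j) (memLp_coord v j)]
  ring

theorem op_smul (c : ℝ) (u : L2 p) : G.op (c • u) = c • G.op u := by
  apply Lp.ext
  filter_upwards [G.op_coeFn (c • u), G.op_coeFn u,
    Lp.coeFn_smul c (G.op u), G.response_congr_ae (Lp.coeFn_smul c u)] with t h1 h2 h4 h5
  rw [h1, h4, Pi.smul_apply, h2, h5]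
  ext i
  simp only [response, PiLp.smul_apply, Pi.smul_apply, smul_eq_mul]
  rw [Finset.mul_sum]
  refine Finset.sum_congr rfl fun j _ => ?_
  rw [causalConv_const_mul]
  ring

/-- Young's inequality entry by entry; the constant is the crude sum over all entries of `|f(∞)|`
plus the `L₁` norm of the impulse response. -/
theorem exists_norm_op_le : ∃ C : ℝ, ∀ u : L2 p, ‖G.op u‖ ≤ C * ‖u‖ := by
  have hK : ∀ i j, ∫⁻ s in Ici 0, ‖impulseResponse (G.tf i j) s‖ₑ < ⊤ := fun i j =>
    ((integrableOn_Ici_iff_integrableOn_Ioi (by simp)).2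
      (integrableOn_impulseResponse (G.properStable i j))).2
  set C : ℝ≥0∞ := ∑ i, ∑ j, (‖feedthrough (G.tf i j)‖ₑ
    + ∫⁻ s in Ici 0, ‖impulseResponse (G.tf i j) s‖ₑ) with hC
  have hCtop : C ≠ ⊤ := by
    refine (ENNReal.sum_lt_top.2 fun i _ => ENNReal.sum_lt_top.2 fun j _ => ?_).ne
    exact ENNReal.add_lt_top.2 ⟨enorm_lt_top, hK i j⟩
  refine ⟨C.toReal, fun u => ?_⟩
  have hcoord : ∀ j, eLpNorm (fun s => u s j) 2 timeMeasure ≤ eLpNorm u 2 timeMeasure := fun j =>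
    eLpNorm_mono fun t => PiLp.norm_apply_le _ _
  have hmeas : ∀ j, StronglyMeasurable fun s => u s j := fun j =>
    (EuclideanSpace.proj (𝕜 := ℝ) j).continuous.comp_stronglyMeasurable (Lp.stronglyMeasurable u)
  have hconv : ∀ i j, StronglyMeasurable (causalConv (impulseResponse (G.tf i j)) fun s => u s j) :=
    fun i j => stronglyMeasurable_causalConv _ _ (stronglyMeasurable_impulseResponse _) (hmeas j)
  have hterm : ∀ i j, eLpNorm (fun t => feedthrough (G.tf i j) * u t j
      + causalConv (impulseResponse (G.tf i j)) (fun s => u s j) t) 2 timeMeasure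
      ≤ (‖feedthrough (G.tf i j)‖ₑ + ∫⁻ s in Ici 0, ‖impulseResponse (G.tf i j) s‖ₑ)
        * eLpNorm u 2 timeMeasure := by
    intro i j
    rw [add_mul]
    refine (eLpNorm_add_le ((hmeas j).const_mul _).aestronglyMeasurable
      (hconv i j).aestronglyMeasurable (by norm_num)).trans (add_le_add ?_ ?_)
    · refine (eLpNorm_const_smul_le (c := feedthrough (G.tf i j)) (f := fun t => u t j)).trans ?_
      gcongr
      exact hcoord j
    · refine (eLpNorm_causalConv_le _ _ (stronglyMeasurable_impulseResponse _) (hmeas j)).trans ?_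
      gcongr
      exact hcoord j
  have hrow : ∀ i, eLpNorm (fun t => G.response u t i) 2 timeMeasure
      ≤ ∑ j, (‖feedthrough (G.tf i j)‖ₑ + ∫⁻ s in Ici 0, ‖impulseResponse (G.tf i j) s‖ₑ)
        * eLpNorm u 2 timeMeasure := by
    intro i
    refine le_trans (le_of_eq ?_) ((eLpNorm_sum_le (s := Finset.univ) (f := fun j t =>
      feedthrough (G.tf i j) * u t j
      + causalConv (impulseResponse (G.tf i j)) (fun s => u s j) t) (fun j _ =>
        (((hmeas j).const_mul _).add (hconv i j)).aestronglyMeasurable) (by norm_num)).trans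
      (Finset.sum_le_sum fun j _ => hterm i j))
    congr 1
    funext t
    simp [response]
  have hall : eLpNorm (G.response u) 2 timeMeasure ≤ C * eLpNorm u 2 timeMeasure := by
    have h1 : eLpNorm (G.response u) 2 timeMeasure
        ≤ eLpNorm (∑ i, fun t => ‖G.response u t i‖) 2 timeMeasure := by
      refine eLpNorm_mono_real fun t => ?_
      rw [Finset.sum_apply]
      have h := norm_sum_le (Finset.univ : Finset (Fin q))
        fun i => EuclideanSpace.single i (G.response u t i)
      simp only [PiLp.norm_single] at h
      refine le_trans (le_of_eq ?_) h
      congr 1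
      ext k
      simp [Finset.sum_apply]
    refine h1.trans ((eLpNorm_sum_le (fun i _ => ?_) (by norm_num)).trans ?_)
    · exact (((EuclideanSpace.proj (𝕜 := ℝ) i).comp_memLp' (G.memLp_response u)).1).norm
    · rw [hC, Finset.sum_mul]
      refine Finset.sum_le_sum fun i _ => ?_
      rw [Finset.sum_mul, eLpNorm_norm]
      exact hrow i
  have h := ENNReal.toReal_mono (ENNReal.mul_ne_top hCtop (Lp.memLp u).2.ne) hall
  rw [ENNReal.toReal_mul] at h
  rw [op, Lp.norm_toLp, Lp.norm_def]
  exact h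

/-- The operator of a stable transfer matrix as a bounded linear map. -/
noncomputable def opL : L2 p →L[ℝ] L2 q :=
  LinearMap.mkContinuousOfExistsBound
    { toFun := G.op
      map_add' := G.op_add
      map_smul' := G.op_smul } G.exists_norm_op_le

@[simp] theorem opL_apply (u : L2 p) : G.opL u = G.op u := rfl

theorem isCausal_op : IsCausal G.op := by
  intro u T
  rw [trunc_eq_trunc_iff]
  have hae : ∀ᵐ s ∂timeMeasure, s ≤ (T : ℝ) → u s = trunc T u s :=
    (trunc_eq_trunc_iff T u (trunc T u)).1 (trunc_trunc T u).symm
  filter_upwards [G.op_coeFn u, G.op_coeFn (trunc T u), hae] with t h1 h2 h3 htT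
  rw [h1, h2]
  exact G.response_congr (h3 htT) (hae.mono fun s hs hst => hs (hst.trans htT))

end RHInfty

theorem IsCausal.trunc_congr {p q : ℕ} {R : L2 p → L2 q} (hR : IsCausal R) {T : ℝ≥0} {u v : L2 p}
    (h : trunc T u = trunc T v) : trunc T (R u) = trunc T (R v) := by
  rw [hR u T, hR v T, h]

/-! ### Points of scaled relative graphs -/

open InnerProductGeometry

section SRG

variable {H : Type*} [NormedAddCommGroup H] [InnerProductSpace ℝ H]

/-- The point `(‖y‖ / ‖x‖) e^{iσ∠(x, y)}` that a pair of increments contributes to an SRG. -/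
noncomputable def srgPoint (x y : H) (σ : ℝ) : ℂ :=
  ((‖y‖ / ‖x‖ : ℝ) : ℂ) * Complex.exp ((σ * angle x y : ℝ) * Complex.I)

/-- `C` contains both points contributed by the increments `x` and `y`. -/
def CoversPair (C : Set (OnePoint ℂ)) (x y : H) : Prop :=
  ∀ σ : ℝ, σ = 1 ∨ σ = -1 → ((srgPoint x y σ : ℂ) : OnePoint ℂ) ∈ C

theorem norm_srgPoint (x y : H) (σ : ℝ) : ‖srgPoint x y σ‖ = ‖y‖ / ‖x‖ := by
  rw [srgPoint, norm_mul, Complex.norm_exp_ofReal_mul_I, mul_one, Complex.norm_real,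
    Real.norm_of_nonneg (by positivity)]

theorem srgPoint_zero_right (x : H) (σ : ℝ) : srgPoint x 0 σ = 0 := by
  simp [srgPoint]

theorem conj_srgPoint (x y : H) (σ : ℝ) :
    starRingEnd ℂ (srgPoint x y σ) = srgPoint x y (-σ) := by
  simp only [srgPoint, map_mul, Complex.conj_ofReal, ← Complex.exp_conj, Complex.conj_I]
  congr 2
  push_cast; ring

/-- The inversion of the extended plane keeps the argument, and angles are symmetric, so inverting a
point exchanges input and output. This is why `setInv` models the inverse relation. -/
theorem inv_conj_srgPoint (x y : H) (σ : ℝ) :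
    (starRingEnd ℂ (srgPoint x y σ))⁻¹ = srgPoint y x σ := by
  rw [conj_srgPoint, srgPoint, srgPoint, mul_inv, ← Complex.ofReal_inv, inv_div, ← Complex.exp_neg,
    angle_comm y x]
  congr 2
  push_cast; ring

theorem re_srgPoint {x y : H} (hx : x ≠ 0) {σ : ℝ} (hσ : σ = 1 ∨ σ = -1) :
    (srgPoint x y σ).re = inner ℝ x y / ‖x‖ ^ 2 := by
  have hx' : ‖x‖ ≠ 0 := norm_ne_zero_iff.2 hx
  rw [srgPoint, Complex.re_ofReal_mul, Complex.exp_ofReal_mul_I_re,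
    ← cos_angle_mul_norm_mul_norm]
  have : Real.cos (σ * angle x y) = Real.cos (angle x y) := by
    rcases hσ with rfl | rfl <;> simp
  rw [this]
  field_simp

/-- `‖y‖ sin ∠(x, y)` is the distance from `y` to the line spanned by `x`; the two are compared
through their squares. -/
theorem im_srgPoint {x y : H} (hx : x ≠ 0) {σ : ℝ} (hσ : σ = 1 ∨ σ = -1) :
    (srgPoint x y σ).im = σ * (‖y - (inner ℝ x y / ‖x‖ ^ 2) • x‖ / ‖x‖) := by
  have hx' : ‖x‖ ≠ 0 := norm_ne_zero_iff.2 hx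
  have hs : Real.sin (σ * angle x y) = σ * Real.sin (angle x y) := by
    rcases hσ with rfl | rfl <;> simp
  have h : ‖y - (inner ℝ x y / ‖x‖ ^ 2) • x‖ = ‖y‖ * Real.sin (angle x y) := by
    rw [← sq_eq_sq₀ (norm_nonneg _) (mul_nonneg (norm_nonneg _) (sin_angle_nonneg _ _)),
      mul_pow, Real.sin_sq, norm_sub_sq_real, norm_smul, inner_smul_right, real_inner_comm,
      ← cos_angle_mul_norm_mul_norm, mul_pow, Real.norm_eq_abs, sq_abs,
      angle_comm y x]
    field_simp
    ring
  rw [srgPoint, Complex.im_ofReal_mul, Complex.exp_ofReal_mul_I_im, hs, h]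
  ring

/-- The point `srgPoint x y σ` in terms of the components of `y` along `x` and orthogonal to `x`. -/
theorem srgPoint_eq {x y : H} (hx : x ≠ 0) {σ : ℝ} (hσ : σ = 1 ∨ σ = -1) :
    srgPoint x y σ = ⟨inner ℝ x y / ‖x‖ ^ 2,
      σ * (‖y - (inner ℝ x y / ‖x‖ ^ 2) • x‖ / ‖x‖)⟩ :=
  Complex.ext (re_srgPoint hx hσ) (im_srgPoint hx hσ)

theorem mem_chord_of_abs_le {a b s : ℝ} (h : |s| ≤ b) : (⟨a, s⟩ : ℂ) ∈ chord ⟨a, b⟩ := by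
  have hs := abs_le.1 h
  rcases eq_or_lt_of_le ((abs_nonneg s).trans h) with hb | hb
  · subst hb
    have : s = 0 := by linarith [hs.1, hs.2]
    subst this
    exact left_mem_segment _ _ _
  · refine ⟨(1 + s / b) / 2, (1 - s / b) / 2, ?_, ?_, by ring, ?_⟩
    · have : -1 ≤ s / b := by rw [le_div_iff₀ hb]; linarith [hs.1]
      linarith
    · have : s / b ≤ 1 := by rw [div_le_iff₀ hb]; linarith [hs.2]
      linarith
    · apply Complex.ext
      · simp; ring
      · simp; field_simp; ring

theorem self_mem_chord (z : ℂ) : z ∈ chord z := left_mem_segment _ _ _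

theorem self_mem_rightArc (z : ℂ) : z ∈ rightArc z :=
  ⟨0, by simp, by simp [Complex.norm_mul_exp_arg_mul_I]⟩

theorem self_mem_leftArc (z : ℂ) : z ∈ leftArc z := self_mem_rightArc (-z)

theorem subset_completion {S : ℂ → Set ℂ} (hS : ∀ z, z ∈ S z) (C : Set (OnePoint ℂ)) :
    C ⊆ completion S C := by
  intro z hz
  induction z using OnePoint.rec with
  | infty => exact Or.inr ⟨rfl, hz⟩
  | coe z => exact Or.inl ⟨z, hz, z, hS z, rfl⟩

theorem mem_completion {S : ℂ → Set ℂ} {C : Set (OnePoint ℂ)} {z v : ℂ}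
    (hz : (z : OnePoint ℂ) ∈ C) (hv : v ∈ S z) : (v : OnePoint ℂ) ∈ completion S C :=
  Or.inl ⟨z, hz, v, hv, rfl⟩

theorem setAdd_subset_improvedAdd (C₁ C₂ : Set (OnePoint ℂ)) :
    setAdd C₁ C₂ ⊆ improvedAdd C₁ C₂ :=
  subset_inter (image2_subset_right (subset_completion self_mem_chord _))
    (image2_subset_left (subset_completion self_mem_chord _))

theorem setMul_subset_improvedMul (C₁ C₂ : Set (OnePoint ℂ)) :
    setMul C₁ C₂ ⊆ improvedMul C₁ C₂ :=
  subset_inter (subset_inter (subset_inter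
    (image2_subset_right (subset_completion self_mem_rightArc _))
    (image2_subset_left (subset_completion self_mem_rightArc _)))
    (image2_subset_right (subset_completion self_mem_leftArc _)))
    (image2_subset_left (subset_completion self_mem_leftArc _))

theorem coe_add_mem_setAdd {C₁ C₂ : Set (OnePoint ℂ)} {z w : ℂ} (hz : (z : OnePoint ℂ) ∈ C₁)
    (hw : (w : OnePoint ℂ) ∈ C₂) : ((z + w : ℂ) : OnePoint ℂ) ∈ setAdd C₁ C₂ :=
  ⟨_, hz, _, hw, rfl⟩

theorem coe_mul_mem_setMul {C₁ C₂ : Set (OnePoint ℂ)} {z w : ℂ} (hz : (z : OnePoint ℂ) ∈ C₁)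
    (hw : (w : OnePoint ℂ) ∈ C₂) : ((z * w : ℂ) : OnePoint ℂ) ∈ setMul C₁ C₂ :=
  ⟨_, hz, _, hw, rfl⟩

theorem infty_extMul (z : OnePoint ℂ) : extMul OnePoint.infty z = OnePoint.infty := rfl

theorem extMul_infty (z : OnePoint ℂ) : extMul z OnePoint.infty = OnePoint.infty := by
  induction z using OnePoint.rec <;> rfl

theorem extAdd_infty (z : OnePoint ℂ) : extAdd z OnePoint.infty = OnePoint.infty := by
  induction z using OnePoint.rec <;> rfl

theorem extInv_coe {z : ℂ} (hz : z ≠ 0) :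
    extInv (z : OnePoint ℂ) = (((starRingEnd ℂ z)⁻¹ : ℂ) : OnePoint ℂ) := if_neg hz

theorem extInv_zero : extInv ((0 : ℂ) : OnePoint ℂ) = OnePoint.infty := if_pos rfl

theorem extInv_infty : extInv OnePoint.infty = ((0 : ℂ) : OnePoint ℂ) := rfl

theorem abs_sign_mul {σ : ℝ} (hσ : σ = 1 ∨ σ = -1) (a : ℝ) : |σ * a| = |a| := by
  rcases hσ with rfl | rfl <;> simp

/-- Real parts add exactly. The imaginary part of the sum is the norm of a sum of orthogonal
components `v + w`, and `|‖v + w‖ - ‖w‖| ≤ ‖v‖` says that after removing the second point the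
remainder lies on the chord of the first. Exchanging the summands gives the other half of the
intersection. -/
theorem CoversPair.improvedAdd {C₁ C₂ : Set (OnePoint ℂ)} {x y₁ y₂ : H} (hx : x ≠ 0)
    (h₁ : CoversPair C₁ x y₁) (h₂ : CoversPair C₂ x y₂) :
    CoversPair (improvedAdd C₁ C₂) x (y₁ + y₂) := by
  intro σ hσ
  have h1 := h₁ 1 (Or.inl rfl)
  have h2 := h₂ 1 (Or.inl rfl)
  have h1' := h₁ σ hσ
  have h2' := h₂ σ hσ
  rw [srgPoint_eq hx (Or.inl rfl), one_mul] at h1 h2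
  rw [srgPoint_eq hx hσ] at h1' h2' ⊢
  set a₁ := inner ℝ x y₁ / ‖x‖ ^ 2
  set a₂ := inner ℝ x y₂ / ‖x‖ ^ 2
  have ha : inner ℝ x (y₁ + y₂) / ‖x‖ ^ 2 = a₁ + a₂ := by rw [inner_add_right, add_div]
  have ho : y₁ + y₂ - (a₁ + a₂) • x = (y₁ - a₁ • x) + (y₂ - a₂ • x) := by
    rw [add_smul]; abel
  rw [ha, ho]
  have hbd : ∀ v w : H, |‖v + w‖ / ‖x‖ - ‖w‖ / ‖x‖| ≤ ‖v‖ / ‖x‖ := by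
    intro v w
    rw [← sub_div, abs_div, abs_norm]
    gcongr
    simpa using abs_norm_sub_norm_le (v + w) w
  refine ⟨?_, ?_⟩
  · have := coe_add_mem_setAdd (mem_completion h1 (mem_chord_of_abs_le (a := a₁)
      (s := σ * (‖(y₁ - a₁ • x) + (y₂ - a₂ • x)‖ / ‖x‖ - ‖y₂ - a₂ • x‖ / ‖x‖))
      (by rw [abs_sign_mul hσ]; exact hbd _ _))) h2'
    convert this using 2
    apply Complex.ext <;> simp
    ring
  · have := coe_add_mem_setAdd h1' (mem_completion h2 (mem_chord_of_abs_le (a := a₂)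
      (s := σ * (‖(y₁ - a₁ • x) + (y₂ - a₂ • x)‖ / ‖x‖ - ‖y₁ - a₁ • x‖ / ‖x‖))
      (by rw [abs_sign_mul hσ, add_comm (y₁ - _)]; exact hbd _ _)))
    convert this using 2
    apply Complex.ext <;> simp
    ring

/-- A factor `-τ ≤ 0` reflects the point through the origin, so the point of sign `σ` comes from the
conjugate point, of sign `-σ`. -/
theorem CoversPair.setScale {C : Set (OnePoint ℂ)} {x y : H} (hx : x ≠ 0) {τ : ℝ} (hτ : 0 ≤ τ)
    (h : CoversPair C x y) : CoversPair (setScale (-τ) C) x (-(τ • y)) := by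
  intro σ hσ
  have hσ' : -σ = 1 ∨ -σ = -1 := by rcases hσ with rfl | rfl <;> simp
  refine ⟨_, h (-σ) hσ', ?_⟩
  change (((((-τ : ℝ) : ℂ) * srgPoint x y (-σ) : ℂ)) : OnePoint ℂ) = _
  congr 1
  rw [srgPoint_eq hx hσ', srgPoint_eq hx hσ]
  have e : -(τ • y) - (inner ℝ x (-(τ • y)) / ‖x‖ ^ 2) • x
      = -(τ • (y - (inner ℝ x y / ‖x‖ ^ 2) • x)) := by
    rw [inner_neg_right, inner_smul_right, smul_sub, smul_smul, neg_div, neg_smul, mul_div_assoc]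
    abel
  rw [e, norm_neg, norm_smul, Real.norm_of_nonneg hτ, inner_neg_right, inner_smul_right]
  apply Complex.ext <;> simp <;> ring

theorem CoversPair.setInv {C : Set (OnePoint ℂ)} {x y : H} (hx : x ≠ 0) (hy : y ≠ 0)
    (h : CoversPair C x y) : CoversPair (setInv C) y x := by
  intro σ hσ
  refine ⟨_, h σ hσ, ?_⟩
  have h0 : srgPoint x y σ ≠ 0 := by
    rw [← norm_ne_zero_iff, norm_srgPoint]
    exact div_ne_zero (norm_ne_zero_iff.2 hy) (norm_ne_zero_iff.2 hx)
  rw [extInv_coe h0, inv_conj_srgPoint]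

theorem mem_rightArc {r θ φ : ℝ} (hr : 0 < r) (hθ : θ ≤ Real.pi) (hφ : |φ| ≤ θ) :
    (r : ℂ) * Complex.exp ((φ : ℝ) * Complex.I)
      ∈ rightArc ((r : ℂ) * Complex.exp ((θ : ℝ) * Complex.I)) := by
  have h0 : 0 ≤ θ := (abs_nonneg _).trans hφ
  have harg : ((r : ℂ) * Complex.exp ((θ : ℝ) * Complex.I)).arg = θ := by
    rw [Complex.exp_mul_I]
    exact Complex.arg_mul_cos_add_sin_mul_I hr ⟨by linarith [Real.pi_pos], hθ⟩
  have hnorm : ‖(r : ℂ) * Complex.exp ((θ : ℝ) * Complex.I)‖ = r := by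
    rw [norm_mul, Complex.norm_exp_ofReal_mul_I, mul_one, Complex.norm_real,
      Real.norm_of_nonneg hr.le]
  unfold rightArc
  rw [mem_ofPred_eq, harg, hnorm]
  have hφ' := abs_le.1 hφ
  rcases eq_or_lt_of_le h0 with h | h
  · have : φ = 0 := by linarith [hφ'.1, hφ'.2]
    exact ⟨0, by simp, by simp [this, ← h]⟩
  -- This `α` solves `(1 - 2α) θ = φ`.
  · refine ⟨(1 - φ / θ) / 2, ⟨?_, ?_⟩, ?_⟩
    · have : φ / θ ≤ 1 := by rw [div_le_iff₀ h]; linarith [hφ'.2]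
      linarith
    · have : -1 ≤ φ / θ := by rw [le_div_iff₀ h]; linarith [hφ'.1]
      linarith
    · congr 4
      field_simp
      ring

/-- The base point is taken with argument `-θ`: its negative then has principal argument exactly `π
- θ ∈ [0, π]`, also at `θ = 0`, where `+θ` would meet the branch cut. -/
theorem mem_leftArc {r θ φ σ : ℝ} (hr : 0 < r) (hθ : 0 ≤ θ) (hσ : σ = 1 ∨ σ = -1)
    (hφ : |φ - Real.pi| ≤ Real.pi - θ) :
    (r : ℂ) * Complex.exp ((σ * φ : ℝ) * Complex.I)
      ∈ leftArc ((r : ℂ) * Complex.exp ((-1 * θ : ℝ) * Complex.I)) := by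
  have h := mem_rightArc (r := r) (θ := Real.pi - θ) (φ := σ * (φ - Real.pi)) hr (by linarith)
    (by rwa [abs_sign_mul hσ])
  have e1 : (r : ℂ) * Complex.exp ((Real.pi - θ : ℝ) * Complex.I)
      = -((r : ℂ) * Complex.exp ((-1 * θ : ℝ) * Complex.I)) := by
    rw [show ((Real.pi - θ : ℝ) : ℂ) * Complex.I
      = Real.pi * Complex.I + ((-1 * θ : ℝ) : ℂ) * Complex.I by push_cast; ring,
      Complex.exp_add, Complex.exp_pi_mul_I]
    ring
  have e2 : (r : ℂ) * Complex.exp ((σ * (φ - Real.pi) : ℝ) * Complex.I)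
      = -((r : ℂ) * Complex.exp ((σ * φ : ℝ) * Complex.I)) := by
    have e3 : Complex.exp (-(σ * Real.pi : ℝ) * Complex.I) = -1 := by
      rcases hσ with rfl | rfl
      · simp [Complex.exp_neg]
      · simp
    rw [show ((σ * (φ - Real.pi) : ℝ) : ℂ) * Complex.I
      = -(σ * Real.pi : ℝ) * Complex.I + ((σ * φ : ℝ) : ℂ) * Complex.I by push_cast; ring,
      Complex.exp_add, e3]
    ring
  rw [e1, e2] at h
  exact h

/-- A spherical triangle has perimeter at most `2π`: apply the triangle inequality through the
antipode `-y`. -/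
theorem angle_le_two_pi_sub (x y z : H) : angle x z ≤ 2 * Real.pi - angle x y - angle y z := by
  have h := angle_le_angle_add_angle x (-y) z
  rw [angle_neg_right, angle_neg_left] at h
  linarith

theorem norm_div_mul_exp {E : Type*} [NormedAddCommGroup E] {x y z : E} (hx : x ≠ 0) (hy : y ≠ 0) {s₁ s₂ s : ℝ} (h : s₁ + s₂ = s) :
    ((‖z‖ / ‖y‖ : ℝ) : ℂ) * Complex.exp ((s₁ : ℝ) * Complex.I) *
      (((‖y‖ / ‖x‖ : ℝ) : ℂ) * Complex.exp ((s₂ : ℝ) * Complex.I))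
      = ((‖z‖ / ‖x‖ : ℝ) : ℂ) * Complex.exp ((s : ℝ) * Complex.I) := by
  have hx' : ‖x‖ ≠ 0 := norm_ne_zero_iff.2 hx
  have hy' : ‖y‖ ≠ 0 := norm_ne_zero_iff.2 hy
  have : ‖z‖ / ‖x‖ = (‖z‖ / ‖y‖) * (‖y‖ / ‖x‖) := by field_simp
  rw [this, ← h, Complex.ofReal_mul, Complex.ofReal_add, add_mul, Complex.exp_add]
  ring

/-- The SRG inclusion for compositions: `y` is the response to `x`, and `z` the response to `y`. -/
theorem CoversPair.improvedMul {C₁ C₂ : Set (OnePoint ℂ)} {x y z : H} (hx : x ≠ 0) (hy : y ≠ 0)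
    (h₁ : CoversPair C₁ y z) (h₂ : CoversPair C₂ x y) : CoversPair (improvedMul C₁ C₂) x z := by
  intro σ hσ
  rcases eq_or_ne z 0 with rfl | hz
  -- For `z = 0` the angle is a convention, but the point is `0` and the plain product already gives
  -- it.
  · apply setMul_subset_improvedMul
    have := coe_mul_mem_setMul (h₁ σ hσ) (h₂ σ hσ)
    rwa [srgPoint_zero_right, zero_mul, ← srgPoint_zero_right x σ] at this
  have hr₁ : 0 < ‖z‖ / ‖y‖ := div_pos (norm_pos_iff.2 hz) (norm_pos_iff.2 hy)
  have hr₂ : 0 < ‖y‖ / ‖x‖ := div_pos (norm_pos_iff.2 hy) (norm_pos_iff.2 hx)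
  have hσ' : -σ = 1 ∨ -σ = -1 := by rcases hσ with rfl | rfl <;> simp
  have t1 := angle_le_angle_add_angle x y z
  have t2 := angle_le_angle_add_angle x z y
  have t3 := angle_le_angle_add_angle y x z
  have t4 := angle_le_two_pi_sub x y z
  rw [angle_comm z y] at t2
  rw [angle_comm y x] at t3
  -- One factor keeps its own point, and its arc partner must supply the missing angle. For right
  -- arcs this is the difference `∠(x, z) - ∠(x, y)` (or with `∠(y, z)`), bounded by the triangle
  -- inequalities. For left arcs the kept factor is conjugated, so the angles add, and the perimeter
  -- bound `t4` enters.
  refine ⟨⟨⟨?_, ?_⟩, ?_⟩, ?_⟩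
  · have h := h₁ 1 (Or.inl rfl)
    rw [srgPoint, one_mul] at h
    have := coe_mul_mem_setMul (mem_completion h (mem_rightArc (φ := σ * (angle x z - angle x y))
      hr₁ (angle_le_pi _ _) (by rw [abs_sign_mul hσ, abs_le]; constructor <;> linarith))) (h₂ σ hσ)
    rw [srgPoint, norm_div_mul_exp hx hy (s := σ * angle x z) (by ring)] at this
    exact this
  · have h := h₂ 1 (Or.inl rfl)
    rw [srgPoint, one_mul] at h
    have := coe_mul_mem_setMul (h₁ σ hσ) (mem_completion h (mem_rightArc
      (φ := σ * (angle x z - angle y z))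
      hr₂ (angle_le_pi _ _) (by rw [abs_sign_mul hσ, abs_le]; constructor <;> linarith)))
    rw [srgPoint, norm_div_mul_exp hx hy (s := σ * angle x z) (by ring)] at this
    exact this
  · have := coe_mul_mem_setMul (mem_completion (h₁ (-1) (Or.inr rfl))
      (mem_leftArc (φ := angle x z + angle x y)
      hr₁ (angle_nonneg _ _) hσ (by rw [abs_le]; constructor <;> linarith))) (h₂ (-σ) hσ')
    rw [srgPoint, norm_div_mul_exp hx hy (s := σ * angle x z) (by ring)] at this
    exact this
  · have := coe_mul_mem_setMul (h₁ (-σ) hσ') (mem_completion (h₂ (-1) (Or.inr rfl))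
      (mem_leftArc (φ := angle x z + angle y z)
      hr₂ (angle_nonneg _ _) hσ (by rw [abs_le]; constructor <;> linarith)))
    rw [srgPoint, norm_div_mul_exp hx hy (s := σ * angle x z) (by ring)] at this
    exact this

end SRG

/-- The radius is an infimum, so each `ε` only yields the bound `Γ + ε`; finiteness comes from one
`ε`, the sharp bound from letting `ε` tend to `0`. -/
theorem exists_coe_of_radius_le {C : Set (OnePoint ℂ)} {Γ : ℝ≥0} (h : radius C ≤ Γ)
    {z : OnePoint ℂ} (hz : z ∈ C) : ∃ c : ℂ, z = c ∧ ‖c‖ ≤ Γ := by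
  have key : ∀ ε : ℝ≥0, 0 < ε → ∃ c : ℂ, z = c ∧ ‖c‖ ≤ Γ + ε := by
    intro ε hε
    have hlt : radius C < ((Γ + ε : ℝ≥0) : ℝ≥0∞) :=
      h.trans_lt (by exact_mod_cast lt_add_of_pos_right Γ hε)
    unfold radius at hlt
    simp only [iInf_lt_iff] at hlt
    obtain ⟨r, _, hC, hr⟩ := hlt
    obtain ⟨c, hc, rfl⟩ := hC hz
    refine ⟨c, rfl, (mem_closedBall_zero_iff.1 hc).trans ?_⟩
    exact_mod_cast hr.le
  obtain ⟨c, rfl, -⟩ := key 1 one_pos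
  refine ⟨c, rfl, le_of_forall_pos_le_add fun ε hε => ?_⟩
  obtain ⟨c', hc', hle⟩ := key ⟨ε, hε.le⟩ hε
  rw [OnePoint.coe_injective hc']
  exact hle

/-! ### The SRG of a non-square operator contains the points of its increments -/

theorem resize_coeFn (m n : ℕ) (u : L2 m) :
    resize m n u =ᵐ[timeMeasure] fun t => resizeVec m n (u t) :=
  ContinuousLinearMap.coeFn_compLpL _ _

theorem resizeVec_apply (m n : ℕ) (x : EuclideanSpace ℝ (Fin m)) (i : Fin n) :
    resizeVec m n x i = if h : (i : ℕ) < m then x ⟨i, h⟩ else 0 := rfl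

theorem norm_resizeVec {m n : ℕ} (h : m ≤ n) (x : EuclideanSpace ℝ (Fin m)) :
    ‖resizeVec m n x‖ = ‖x‖ := by
  obtain ⟨k, rfl⟩ := Nat.exists_eq_add_of_le h
  rw [EuclideanSpace.norm_eq, EuclideanSpace.norm_eq, Fin.sum_univ_add]
  simp [resizeVec_apply]

/-- The hypothesis ensures that the intermediate dimension `m` cuts no coordinate that both ends
retain. -/
theorem resize_resize {l m n : ℕ} (h : l ≤ m ∨ n ≤ m) (u : L2 l) :
    resize m n (resize l m u) = resize l n u := by
  apply Lp.ext
  filter_upwards [resize_coeFn m n (resize l m u), resize_coeFn l m u, resize_coeFn l n u]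
    with t h1 h2 h3
  rw [h1, h2, h3]
  ext i
  simp only [resizeVec_apply]
  have := i.2
  by_cases hl : (i : ℕ) < l <;> by_cases hm : (i : ℕ) < m <;> simp [hl, hm]
  omega

theorem resize_self {n : ℕ} (u : L2 n) : resize n n u = u := by
  apply Lp.ext
  filter_upwards [resize_coeFn n n u] with t h1
  rw [h1]
  ext i
  simp [resizeVec_apply]

/-- The isometric embedding `L₂^m → L₂^n` for `m ≤ n`. -/
noncomputable def resizeIsometry {m n : ℕ} (h : m ≤ n) : L2 m →ₗᵢ[ℝ] L2 n where
  toLinearMap := resize m n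
  norm_map' u := by
    change ‖resize m n u‖ = ‖u‖
    rw [Lp.norm_def, Lp.norm_def]
    congr 1
    refine eLpNorm_congr_norm_ae ?_
    filter_upwards [resize_coeFn m n u] with t ht
    rw [ht, norm_resizeVec h]

/-- Isometric embeddings preserve norms and angles, so an SRG computed in dimension `max p q` can be
read in any larger `N`. All signals of the loop can thus be compared in one space. -/
theorem coversPair_mimoSRG {p q N : ℕ} (hp : p ≤ N) (hq : q ≤ N) (R : L2 p → L2 q) {u₁ u₂ : L2 p}
    (hu : u₁ ≠ u₂) :
    CoversPair (mimoSRG R) (resizeIsometry hp (u₁ - u₂)) (resizeIsometry hq (R u₁ - R u₂)) := by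
  intro σ hσ
  have hpn : p ≤ max p q := le_max_left _ _
  have hqn : q ≤ max p q := le_max_right _ _
  have hnN : max p q ≤ N := max_le hp hq
  have hback : ∀ u : L2 p, resize (max p q) p (resize p (max p q) u) = u := fun u => by
    rw [resize_resize (Or.inl hpn), resize_self]
  have e1 : ∀ u : L2 p, resizeIsometry hp u = resizeIsometry hnN (resizeIsometry hpn u) :=
    fun u => (resize_resize (Or.inl hpn) u).symm
  have e2 : ∀ u : L2 q, resizeIsometry hq u = resizeIsometry hnN (resizeIsometry hqn u) :=
    fun u => (resize_resize (Or.inl hqn) u).symm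
  refine ⟨_, ⟨u₁, rfl⟩, _, ⟨u₂, rfl⟩, fun h => hu ?_, σ, hσ, ?_⟩
  · rw [← hback u₁, h, hback]
  · simp only [hback, ← map_sub]
    rw [e1, e2, srgPoint, LinearIsometry.angle_map, (resizeIsometry hnN).norm_map,
      (resizeIsometry hnN).norm_map]
    rfl

/-! ### Continuation in the loop gain -/

theorem prop_one_of_uniform_step {Q : ℝ → Prop} (h0 : Q 0) {ε : ℝ} (hε : 0 < ε)
    (step : ∀ τ ∈ Icc (0 : ℝ) 1, ∀ τ' ∈ Icc (0 : ℝ) 1, |τ' - τ| < ε → Q τ → Q τ') : Q 1 := by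
  obtain ⟨n, hn⟩ := exists_nat_one_div_lt hε
  have hn0 : (0 : ℝ) < n + 1 := by positivity
  have key : ∀ k : ℕ, k ≤ n + 1 → Q (k / (n + 1)) := by
    intro k
    induction k with
    | zero => intro _; simpa using h0
    | succ k ih =>
      intro hk
      have hk' : ((k + 1 : ℕ) : ℝ) ≤ n + 1 := by exact_mod_cast hk
      have hk0 : (k : ℝ) ≤ n + 1 := by push_cast at hk'; linarith
      refine step _ ⟨by positivity, (div_le_one hn0).2 hk0⟩ _
        ⟨by positivity, (div_le_one hn0).2 hk'⟩ ?_ (ih (by omega))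
      rw [← sub_div]
      push_cast
      rwa [add_sub_cancel_left, abs_of_pos (by positivity)]
  have := key (n + 1) le_rfl
  push_cast at this
  rwa [div_self hn0.ne'] at this

section Continuation

variable {E : Type*} [NormedAddCommGroup E] [NormedSpace ℝ E] {B : E → E} {b K : ℝ}

/-- Rewrite `x - τ' B x = v` as `x - τ B x = v + (τ' - τ) B x`. A right inverse at `τ` is
`K`-Lipschitz by `hexp`, so the equation is a fixed point problem with contraction factor `K |τ' -
τ| b`. -/
theorem surjective_sub_smul_step [CompleteSpace E] (hb : 0 ≤ b) (hK : 0 ≤ K)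
    (hB : ∀ x y, ‖B x - B y‖ ≤ b * ‖x - y‖) {τ τ' : ℝ}
    (hexp : ∀ x y, ‖x - y‖ ≤ K * ‖(x - τ • B x) - (y - τ • B y)‖)
    (hs : Function.Surjective fun x => x - τ • B x) (hδ : K * (|τ' - τ| * b) < 1) :
    Function.Surjective fun x => x - τ' • B x := by
  obtain ⟨g, hg⟩ := hs.hasRightInverse
  have hg' : ∀ v, g v - τ • B (g v) = v := hg
  intro v
  have hc : ContractingWith (NNReal.mk (K * (|τ' - τ| * b)) (by positivity))
      fun x => g (v + (τ' - τ) • B x) := by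
    refine ⟨by exact_mod_cast hδ, LipschitzWith.of_dist_le_mul fun x y => ?_⟩
    rw [dist_eq_norm, dist_eq_norm]
    refine (hexp _ _).trans ?_
    rw [hg', hg', add_sub_add_left_eq_sub, ← smul_sub, norm_smul, Real.norm_eq_abs, NNReal.coe_mk,
      mul_assoc, mul_assoc]
    gcongr
    exact hB x y
  have hfix := hc.fixedPoint_isFixedPt
  set x := hc.fixedPoint with hx
  refine ⟨x, ?_⟩
  have h := hg' (v + (τ' - τ) • B x)
  have hfix' : g (v + (τ' - τ) • B x) = x := hfix
  rw [hfix', sub_smul] at h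
  change x - τ' • B x = v
  rw [sub_eq_iff_eq_add] at h ⊢
  exact h.trans (by abel)

/-- The expansion estimate compares whole signals, not truncations, so the truncated outputs at `τ`
are first lifted to genuine outputs. This bounds `‖P x - P y‖` by a factor less than one times
itself. -/
theorem truncated_injective_step (hK : 0 ≤ K)
    (hB : ∀ x y, ‖B x - B y‖ ≤ b * ‖x - y‖) {τ τ' : ℝ}
    (hexp : ∀ x y, ‖x - y‖ ≤ K * ‖(x - τ • B x) - (y - τ • B y)‖)
    (hs : Function.Surjective fun x => x - τ • B x) (hδ : K * (|τ' - τ| * b) < 1)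
    {P : E →ₗ[ℝ] E} (hP : ∀ x, ‖P x‖ ≤ ‖x‖) (hPP : ∀ x, P (P x) = P x)
    (hPB : ∀ x, P (B x) = P (B (P x)))
    (hinj : ∀ x y, P (x - τ • B x) = P (y - τ • B y) → P x = P y) :
    ∀ x y, P (x - τ' • B x) = P (y - τ' • B y) → P x = P y := by
  intro x y hxy
  -- `x'` produces the truncated output of `x` and, by injectivity at `τ`, has the same truncation
  -- as `x`.
  obtain ⟨x', hx'⟩ := hs (P (x - τ • B x))
  obtain ⟨y', hy'⟩ := hs (P (y - τ • B y))
  simp only at hx' hy'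
  have ex : P x' = P x := hinj _ _ (by rw [hx', hPP])
  have ey : P y' = P y := hinj _ _ (by rw [hy', hPP])
  have e1 : P (x - τ • B x) - P (y - τ • B y) = (τ' - τ) • P (B (P x) - B (P y)) := by
    rw [map_sub P (B (P x)), ← hPB, ← hPB]
    simp only [map_sub, map_smul] at hxy ⊢
    have : P x - P y = τ' • P (B x) - τ' • P (B y) := by
      rw [sub_eq_iff_eq_add] at hxy ⊢
      rw [hxy]; abel
    rw [sub_smul, smul_sub, smul_sub]
    rw [sub_sub_sub_comm, this]
  have h1 : ‖P x - P y‖ ≤ K * (|τ' - τ| * b) * ‖P x - P y‖ := by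
    calc ‖P x - P y‖ = ‖P (x' - y')‖ := by rw [map_sub, ex, ey]
      _ ≤ ‖x' - y'‖ := hP _
      _ ≤ K * ‖P (x - τ • B x) - P (y - τ • B y)‖ := by rw [← hx', ← hy']; exact hexp _ _
      _ ≤ K * (|τ' - τ| * (b * ‖P x - P y‖)) := by
        rw [e1, norm_smul, Real.norm_eq_abs]
        gcongr
        exact (hP _).trans (hB _ _)
      _ = K * (|τ' - τ| * b) * ‖P x - P y‖ := by ring
  have h2 : ‖P x - P y‖ = 0 := by
    nlinarith [norm_nonneg (P x - P y)]
  exact sub_eq_zero.1 (norm_eq_zero.1 h2)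

theorem exists_step_size (hb : 0 ≤ b) (hK : 0 ≤ K) :
    ∃ ε > 0, ∀ δ : ℝ, |δ| < ε → K * (|δ| * b) < 1 := by
  -- The summand `1` covers the case `K * b = 0`.
  refine ⟨1 / (K * b + 1), by positivity, fun δ hδ => ?_⟩
  rw [lt_div_iff₀ (by positivity)] at hδ
  nlinarith [abs_nonneg δ]

theorem surjective_sub_of_uniform_bound [CompleteSpace E] (hb : 0 ≤ b) (hK : 0 ≤ K)
    (hB : ∀ x y, ‖B x - B y‖ ≤ b * ‖x - y‖)
    (hexp : ∀ τ ∈ Icc (0 : ℝ) 1, ∀ x y, ‖x - y‖ ≤ K * ‖(x - τ • B x) - (y - τ • B y)‖) :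
    Function.Surjective fun x => x - (1 : ℝ) • B x := by
  obtain ⟨ε, hε, h⟩ := exists_step_size hb hK
  refine prop_one_of_uniform_step (Q := fun τ => Function.Surjective fun x => x - τ • B x) ?_ hε ?_
  · intro v; exact ⟨v, by simp⟩
  · intro τ hτ τ' _ hd hs
    exact surjective_sub_smul_step hb hK hB (hexp τ hτ) hs (h _ hd)

/-- Surjectivity is part of the induction because each step lifts truncated outputs at the current
`τ`. -/
theorem truncated_injective_of_uniform_bound [CompleteSpace E] (hb : 0 ≤ b) (hK : 0 ≤ K)
    (hB : ∀ x y, ‖B x - B y‖ ≤ b * ‖x - y‖)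
    (hexp : ∀ τ ∈ Icc (0 : ℝ) 1, ∀ x y, ‖x - y‖ ≤ K * ‖(x - τ • B x) - (y - τ • B y)‖)
    {P : E →ₗ[ℝ] E} (hP : ∀ x, ‖P x‖ ≤ ‖x‖) (hPP : ∀ x, P (P x) = P x)
    (hPB : ∀ x, P (B x) = P (B (P x))) :
    ∀ x y, P (x - (1 : ℝ) • B x) = P (y - (1 : ℝ) • B y) → P x = P y := by
  obtain ⟨ε, hε, h⟩ := exists_step_size hb hK
  refine (prop_one_of_uniform_step (Q := fun τ => (Function.Surjective fun x => x - τ • B x) ∧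
    ∀ x y, P (x - τ • B x) = P (y - τ • B y) → P x = P y) ?_ hε ?_).2
  · exact ⟨fun v => ⟨v, by simp⟩, fun x y hxy => by simpa using hxy⟩
  · intro τ hτ τ' _ hd hs
    exact ⟨surjective_sub_smul_step hb hK hB (hexp τ hτ) hs.1 (h _ hd),
      truncated_injective_step hK hB (hexp τ hτ) hs.1 (h _ hd) hP hPP hPB hs.2⟩

end Continuation

/-! ### The feedback loop of an LFR -/

section Loop

variable {nz nw p q : ℕ} (G : LFRPlant nz nw p q) (Φ : L2 nz → L2 nw)

/-- The map `e ↦ e - τ G_zw Φ e` from the input of `Φ` to the external signal. -/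
noncomputable def loopMap (τ : ℝ) (e : L2 nz) : L2 nz := e - τ • G.zw (Φ e)

/-- The SRG bound for `Φ⁻¹ - τ G_zw`. -/
noncomputable def loopSRG (τ : ℝ) : Set (OnePoint ℂ) :=
  improvedAdd (setInv (mimoSRG Φ)) (setScale (-τ) (mimoSRG G.zw))

variable {G Φ}

theorem loopMap_one (e : L2 nz) : loopMap G Φ 1 e = e - G.zw (Φ e) := by
  rw [loopMap, one_smul]

theorem wellPosed_iff_bijective :
    WellPosed Φ (fun w => -G.zw w) ↔ Function.Bijective (loopMap G Φ 1) := by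
  have hiff : ∀ (u : L2 nz) (s : L2 nz × L2 nw),
      (s.1 = u - -G.zw s.2 ∧ s.2 = Φ s.1) ↔ loopMap G Φ 1 s.1 = u ∧ s.2 = Φ s.1 := by
    intro u s
    rw [loopMap_one, sub_neg_eq_add]
    refine and_congr_left fun h2 => ?_
    rw [← h2, sub_eq_iff_eq_add]
  rw [Function.bijective_iff_existsUnique]
  refine forall_congr' fun u => ⟨?_, ?_⟩
  · rintro ⟨s, hs, hu⟩
    refine ⟨s.1, ((hiff u s).1 hs).1, fun e he => ?_⟩
    exact congrArg Prod.fst (hu (e, Φ e) ((hiff u _).2 ⟨he, rfl⟩))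
  · rintro ⟨e, he, hu⟩
    refine ⟨(e, Φ e), (hiff u _).2 ⟨he, rfl⟩, fun s hs => ?_⟩
    obtain ⟨h1, h2⟩ := (hiff u s).1 hs
    have h3 := hu s.1 h1
    exact Prod.ext h3 (by rw [h2, h3])

theorem lfrRelation_eq_graph {E : L2 nz → L2 nz} (hE : ∀ e v, loopMap G Φ 1 e = v ↔ e = E v) :
    lfrRelation G Φ = Function.graph fun u => G.yw (Φ (E (G.zu u))) + G.yu u := by
  ext ⟨u, y⟩
  constructor
  · rintro ⟨y₁, y₂, ⟨z, hz, w, ⟨e, x, he, hx, hzx⟩, hy₁⟩, hy₂, hy⟩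
    change G.zu u = z at hz
    change Φ e = w at he
    change -G.zw w = x at hx
    change G.yw w = y₁ at hy₁
    change G.yu u = y₂ at hy₂
    change z = e + x at hzx
    change y = y₁ + y₂ at hy
    change G.yw (Φ (E (G.zu u))) + G.yu u = y
    have : e = E z := (hE e z).1 (by rw [loopMap_one, he, hzx, ← hx, sub_eq_add_neg])
    rw [hz, ← this, he, hy₁, hy₂, hy]
  · intro h
    change G.yw (Φ (E (G.zu u))) + G.yu u = y at h
    refine ⟨_, _, ⟨G.zu u, rfl, Φ (E (G.zu u)),
      ⟨E (G.zu u), -G.zw (Φ (E (G.zu u))), rfl, rfl, ?_⟩, rfl⟩, rfl, h.symm⟩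
    change G.zu u = E (G.zu u) + -G.zw (Φ (E (G.zu u)))
    rw [← sub_eq_add_neg, ← loopMap_one]
    exact ((hE _ _).2 rfl).symm

/-- Seen from `Δw`, the increment `Δe` is a response of `Φ⁻¹` and `Δv = Δe - τ G_zw Δw`; the claim
is the sum rule with input `Δw`, which is why `Δw ≠ 0` is required. -/
theorem coversPair_loopSRG {N : ℕ} (hz : nz ≤ N) (hw : nw ≤ N) {τ : ℝ} (hτ : 0 ≤ τ) {e₁ e₂ : L2 nz}
    (h : Φ e₁ ≠ Φ e₂) :
    CoversPair (loopSRG G Φ τ) (resizeIsometry hw (Φ e₁ - Φ e₂))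
      (resizeIsometry hz (loopMap G Φ τ e₁ - loopMap G Φ τ e₂)) := by
  have he : e₁ ≠ e₂ := fun h' => h (by rw [h'])
  have hx : resizeIsometry hw (Φ e₁ - Φ e₂) ≠ 0 :=
    (map_ne_zero_iff _ (resizeIsometry hw).injective).2 (sub_ne_zero.2 h)
  have hx' : resizeIsometry hz (e₁ - e₂) ≠ 0 :=
    (map_ne_zero_iff _ (resizeIsometry hz).injective).2 (sub_ne_zero.2 he)
  have h1 := (coversPair_mimoSRG hz hw Φ he).setInv hx' hx
  have h2 := (coversPair_mimoSRG hw hz G.zw h).setScale hx hτ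
  have := h1.improvedAdd hx h2
  change CoversPair (improvedAdd _ _) _ _
  convert this using 1
  rw [← map_smul, ← map_neg, ← map_add]
  congr 1
  simp only [loopMap, smul_sub]
  abel

/-! ### Witnesses in the SRGs and bounds read off from `A_τ⁻¹`. -/

theorem exists_coe_mem_mimoSRG {m n : ℕ} {R : L2 m → L2 n} {u₁ u₂ : L2 m} (h : u₁ ≠ u₂) :
    ∃ c : ℂ, (c : OnePoint ℂ) ∈ mimoSRG R ∧ ‖c‖ = ‖R u₁ - R u₂‖ / ‖u₁ - u₂‖ := by
  have hc := coversPair_mimoSRG (le_max_left m n) (le_max_right m n) R h 1 (Or.inl rfl)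
  exact ⟨_, hc, by rw [norm_srgPoint, LinearIsometry.norm_map, LinearIsometry.norm_map]⟩

theorem mimoSRG_nonempty {m n : ℕ} (hm : 0 < m) (R : L2 m → L2 n) :
    ∃ c : ℂ, (c : OnePoint ℂ) ∈ mimoSRG R := by
  obtain ⟨u, hu⟩ := nontrivial_L2 hm
  obtain ⟨c, hc, -⟩ := exists_coe_mem_mimoSRG (R := R) hu
  exact ⟨c, hc⟩

theorem zero_mem_mimoSRG {m n : ℕ} {R : L2 m → L2 n} {u₁ u₂ : L2 m} (h : u₁ ≠ u₂)
    (hR : R u₁ = R u₂) : ((0 : ℂ) : OnePoint ℂ) ∈ mimoSRG R := by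
  obtain ⟨c, hc, hn⟩ := exists_coe_mem_mimoSRG (R := R) h
  rw [hR, sub_self, norm_zero, zero_div, norm_eq_zero] at hn
  rwa [hn] at hc

theorem loopSRG_nonempty (hnz : 0 < nz) (hnw : 0 < nw) (τ : ℝ) : (loopSRG G Φ τ).Nonempty := by
  obtain ⟨a, ha⟩ := mimoSRG_nonempty hnz Φ
  obtain ⟨g, hg⟩ := mimoSRG_nonempty hnw G.zw
  exact ⟨_, setAdd_subset_improvedAdd _ _
    ⟨_, mem_image_of_mem _ ha, _, mem_image_of_mem _ hg, rfl⟩⟩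

/-- `0` in the SRG of `Φ` inverts to `∞`, which absorbs the sum and inverts back to `0`. -/
theorem zero_mem_setInv_loopSRG (hnw : 0 < nw) (τ : ℝ) {e₁ e₂ : L2 nz} (he : e₁ ≠ e₂)
    (h : Φ e₁ = Φ e₂) : ((0 : ℂ) : OnePoint ℂ) ∈ setInv (loopSRG G Φ τ) := by
  obtain ⟨g, hg⟩ := mimoSRG_nonempty hnw G.zw
  exact ⟨OnePoint.infty, setAdd_subset_improvedAdd _ _
    ⟨OnePoint.infty, ⟨_, zero_mem_mimoSRG he h, extInv_zero⟩, _, mem_image_of_mem _ hg, rfl⟩,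
    extInv_infty⟩

/-- Every point of the inverted SRG bound of the loop is finite, and enters the SRG bound of the
LFR through its elementwise products and sums. -/
theorem exists_coe_of_mem_setInv_loopSRG {τ : ℝ} {Γ : ℝ≥0} (h : radius (lfrSRGBound G Φ τ) ≤ Γ)
    {k g c : ℂ} (hk : (k : OnePoint ℂ) ∈ mimoSRG G.yu) (hg : (g : OnePoint ℂ) ∈ mimoSRG G.yw)
    (hc : (c : OnePoint ℂ) ∈ mimoSRG G.zu) {a : OnePoint ℂ} (ha : a ∈ setInv (loopSRG G Φ τ)) :
    ∃ a' : ℂ, a = a' ∧ ‖k + g * a' * c‖ ≤ Γ := by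
  have hmem : extAdd k (extMul (extMul g a) c) ∈ lfrSRGBound G Φ τ :=
    setAdd_subset_improvedAdd _ _ ⟨_, hk, _, setMul_subset_improvedMul _ _
      ⟨_, setMul_subset_improvedMul _ _ ⟨_, hg, _, ha, rfl⟩, _, hc, rfl⟩, rfl⟩
  obtain ⟨b, hb, hle⟩ := exists_coe_of_radius_le h hmem
  induction a using OnePoint.rec with
  | infty =>
    rw [extMul_infty, infty_extMul, extAdd_infty] at hb
    exact absurd hb (OnePoint.infty_ne_coe b)
  | coe a =>
    refine ⟨a, rfl, ?_⟩
    have hb' : ((k + g * a * c : ℂ) : OnePoint ℂ) = b := hb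
    rwa [OnePoint.coe_injective hb']

theorem norm_sub_le_of_setInv_loopSRG {τ M : ℝ} (hτ : 0 ≤ τ)
    (hM : ∀ a ∈ setInv (loopSRG G Φ τ), ∃ c : ℂ, a = c ∧ ‖c‖ ≤ M) (hM0 : 0 ≤ M) (e₁ e₂ : L2 nz) :
    ‖Φ e₁ - Φ e₂‖ ≤ M * ‖loopMap G Φ τ e₁ - loopMap G Φ τ e₂‖ := by
  rcases eq_or_ne (Φ e₁) (Φ e₂) with h | h
  · rw [h, sub_self, norm_zero]; positivity
  have hcov := coversPair_loopSRG (G := G) (le_max_left nz nw) (le_max_right nz nw) hτ h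
  rcases eq_or_ne (loopMap G Φ τ e₁ - loopMap G Φ τ e₂) 0 with h0 | h0
  -- Equal outputs with `Δw ≠ 0` would put `0` into `A_τ`, hence `∞` into its inverse, against `hM`.
  · have h1 := hcov 1 (Or.inl rfl)
    rw [h0, map_zero, srgPoint_zero_right] at h1
    obtain ⟨c, hc, -⟩ := hM _ ⟨_, h1, extInv_zero⟩
    exact absurd hc (OnePoint.infty_ne_coe c)
  · have hx : resizeIsometry (le_max_right nz nw) (Φ e₁ - Φ e₂) ≠ 0 :=
      (map_ne_zero_iff _ (resizeIsometry _).injective).2 (sub_ne_zero.2 h)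
    have hy : resizeIsometry (le_max_left nz nw) (loopMap G Φ τ e₁ - loopMap G Φ τ e₂) ≠ 0 :=
      (map_ne_zero_iff _ (resizeIsometry _).injective).2 h0
    obtain ⟨c, hc, hle⟩ := hM _ (hcov.setInv hx hy 1 (Or.inl rfl))
    rw [← OnePoint.coe_injective hc, norm_srgPoint, LinearIsometry.norm_map,
      LinearIsometry.norm_map, div_le_iff₀ (norm_pos_iff.2 h0)] at hle
    exact hle

/-! ### Invertibility of the loop map and causality of its inverse. -/

theorem norm_zw_le (w : L2 nw) : ‖G.zw w‖ ≤ ‖(RHInfty.block G Sum.inl Sum.inl).opL‖ * ‖w‖ :=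
  (RHInfty.block G Sum.inl Sum.inl).opL.le_opNorm w

theorem zw_sub (w₁ w₂ : L2 nw) : G.zw (w₁ - w₂) = G.zw w₁ - G.zw w₂ :=
  map_sub (RHInfty.block G Sum.inl Sum.inl).opL w₁ w₂

theorem isCausal_zw : IsCausal G.zw := RHInfty.isCausal_op _

theorem isCausal_zu : IsCausal G.zu := RHInfty.isCausal_op _

theorem isCausal_yw : IsCausal G.yw := RHInfty.isCausal_op _

theorem isCausal_yu : IsCausal G.yu := RHInfty.isCausal_op _

theorem norm_sub_le_loopMap {τ M : ℝ} (hτ : τ ∈ Icc (0 : ℝ) 1) {e₁ e₂ : L2 nz}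
    (h : ‖Φ e₁ - Φ e₂‖ ≤ M * ‖loopMap G Φ τ e₁ - loopMap G Φ τ e₂‖) :
    ‖e₁ - e₂‖ ≤ (1 + ‖(RHInfty.block G Sum.inl Sum.inl).opL‖ * M)
      * ‖loopMap G Φ τ e₁ - loopMap G Φ τ e₂‖ := by
  have e : e₁ - e₂ = (loopMap G Φ τ e₁ - loopMap G Φ τ e₂) + τ • G.zw (Φ e₁ - Φ e₂) := by
    rw [zw_sub, loopMap, loopMap, smul_sub]; abel
  calc ‖e₁ - e₂‖ ≤ ‖loopMap G Φ τ e₁ - loopMap G Φ τ e₂‖ + ‖τ • G.zw (Φ e₁ - Φ e₂)‖ := by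
        conv_lhs => rw [e]
        exact norm_add_le _ _
    _ ≤ ‖loopMap G Φ τ e₁ - loopMap G Φ τ e₂‖ + 1 * (‖(RHInfty.block G Sum.inl Sum.inl).opL‖
        * (M * ‖loopMap G Φ τ e₁ - loopMap G Φ τ e₂‖)) := by
        rw [norm_smul, Real.norm_of_nonneg hτ.1]
        gcongr
        · exact hτ.2
        · exact (norm_zw_le _).trans (by gcongr)
    _ = _ := by ring

theorem norm_zw_comp_sub_le (hΦ : incGain Φ < ⊤) (x y : L2 nz) :
    ‖G.zw (Φ x) - G.zw (Φ y)‖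
      ≤ ‖(RHInfty.block G Sum.inl Sum.inl).opL‖ * (incGain Φ).toReal * ‖x - y‖ := by
  rw [← zw_sub, mul_assoc]
  exact (norm_zw_le _).trans (by gcongr; exact norm_sub_le_incGain hΦ x y)

theorem loopMap_bijective (hΦ : incGain Φ < ⊤) {M : ℝ} (hM0 : 0 ≤ M)
    (hM : ∀ τ ∈ Icc (0 : ℝ) 1, ∀ a ∈ setInv (loopSRG G Φ τ), ∃ c : ℂ, a = c ∧ ‖c‖ ≤ M) :
    Function.Bijective (loopMap G Φ 1) := by
  have hexp : ∀ τ ∈ Icc (0 : ℝ) 1, ∀ x y, _ := fun τ hτ x y =>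
    norm_sub_le_loopMap hτ (norm_sub_le_of_setInv_loopSRG hτ.1 (hM τ hτ) hM0 x y)
  refine ⟨fun x y hxy => ?_, surjective_sub_of_uniform_bound (B := fun e => G.zw (Φ e))
    (by positivity) (by positivity) (norm_zw_comp_sub_le hΦ) hexp⟩
  have h := hexp 1 ⟨zero_le_one, le_rfl⟩ x y
  rw [hxy, sub_self, norm_zero, mul_zero] at h
  exact sub_eq_zero.1 (norm_le_zero_iff.1 h)

theorem trunc_eq_of_trunc_loopMap_eq (hΦ : incGain Φ < ⊤) {M : ℝ} (hM0 : 0 ≤ M)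
    (hM : ∀ τ ∈ Icc (0 : ℝ) 1, ∀ a ∈ setInv (loopSRG G Φ τ), ∃ c : ℂ, a = c ∧ ‖c‖ ≤ M)
    (hc : IsCausal Φ) (T : ℝ≥0) {x y : L2 nz}
    (h : trunc T (loopMap G Φ 1 x) = trunc T (loopMap G Φ 1 y)) : trunc T x = trunc T y :=
  truncated_injective_of_uniform_bound (B := fun e => G.zw (Φ e)) (by positivity) (by positivity)
    (norm_zw_comp_sub_le hΦ) (fun τ hτ x y =>
      norm_sub_le_loopMap hτ (norm_sub_le_of_setInv_loopSRG hτ.1 (hM τ hτ) hM0 x y))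
    (P := truncL T) (norm_trunc_le T) (trunc_trunc T)
    (fun x => isCausal_zw.trunc_congr (hc x T)) x y h

/-- The `L₂` solution also solves the extended equations. Conversely, the truncation at `T` of any
extended solution satisfies the loop equation up to time `T`, so `hinj` identifies it with the
truncated `L₂` solution. -/
theorem wellPosedExtended_of_causal_inverse (hc : IsCausal Φ)
    (hs : Function.Surjective (loopMap G Φ 1))
    (hinj : ∀ (T : ℝ≥0) (x y : L2 nz), trunc T (loopMap G Φ 1 x) = trunc T (loopMap G Φ 1 y) →
      trunc T x = trunc T y) :
    WellPosedExtended Φ (fun w => -G.zw w) := by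
  intro u
  obtain ⟨e, he⟩ := hs u
  refine ⟨(L2.toExtended e, L2.toExtended (Φ e)),
    ⟨⟨L2.toExtended (-G.zw (Φ e)), fun T => ?_, ?_⟩, fun T => ?_⟩, ?_⟩
  · change truncL T (-G.zw (Φ e)) = truncL T (-G.zw (trunc T (Φ e)))
    rw [map_neg, map_neg, truncL_apply, truncL_apply, isCausal_zw (Φ e) T]
  · rw [loopMap_one] at he
    change e.1 = u.1 - (-G.zw (Φ e)).1
    rw [← he, AddSubgroup.coe_sub, AddSubgroup.coe_neg]
    abel
  · exact hc e T
  · rintro ⟨e', w'⟩ ⟨⟨v, hv, hev⟩, hw⟩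
    have htrunc : ∀ T, e'.trunc T = trunc T e := by
      intro T
      have h1 := L2e.trunc_eq_sub hev T
      rw [hv T] at h1
      have h2 : trunc T (G.zw (w'.trunc T)) = trunc T (G.zw (Φ (e'.trunc T))) :=
        isCausal_zw.trunc_congr (by rw [L2e.trunc_trunc, hw T])
      have h3 : trunc T (loopMap G Φ 1 (e'.trunc T)) = trunc T (loopMap G Φ 1 e) := by
        rw [he, loopMap_one, ← truncL_apply, map_sub, truncL_apply, truncL_apply,
          L2e.trunc_trunc, ← h2]
        change e'.trunc T = trunc T u - truncL T (-G.zw (w'.trunc T)) at h1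
        rw [map_neg, truncL_apply] at h1
        rw [h1]; abel
      rw [← L2e.trunc_trunc]
      exact hinj T _ _ h3
    have h1 : e' = L2.toExtended e := L2e.ext_trunc fun T => by
      rw [L2.trunc_toExtended]; exact htrunc T
    have h2 : w' = L2.toExtended (Φ e) := L2e.ext_trunc fun T => by
      have := hw T
      simp only at this
      rw [this, L2.trunc_toExtended, htrunc T]
      exact (hc e T).symm
    rw [h1, h2]

theorem isCausal_lfr (hc : IsCausal Φ) {E : L2 nz → L2 nz} (hE : IsCausal E) :
    IsCausal fun u => G.yw (Φ (E (G.zu u))) + G.yu u := by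
  intro u T
  change truncL T _ = truncL T _
  rw [map_add, map_add]
  refine congrArg₂ (· + ·) ?_ (isCausal_yu u T)
  exact isCausal_yw.trunc_congr (hc.trunc_congr (hE.trunc_congr (isCausal_zu u T)))

/-- Chains the SRG inclusions along `Δu ↦ Δz ↦ Δw ↦ Δy` and adds `G_yu`; the modulus of the
resulting point is the incremental quotient of the closed loop. -/
theorem norm_lfr_sub_le (hnz : 0 < nz) (hnw : 0 < nw) {Γ : ℝ≥0}
    (h : radius (lfrSRGBound G Φ 1) ≤ Γ) {E : L2 nz → L2 nz}
    (hE : ∀ e v, loopMap G Φ 1 e = v ↔ e = E v)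
    (hfin : ∀ a ∈ setInv (loopSRG G Φ 1), ∃ c : ℂ, a = c) {u₁ u₂ : L2 p} (hu : u₁ ≠ u₂) :
    ‖(G.yw (Φ (E (G.zu u₁))) + G.yu u₁) - (G.yw (Φ (E (G.zu u₂))) + G.yu u₂)‖
      ≤ Γ * ‖u₁ - u₂‖ := by
  obtain ⟨N, hz, hw, hp, hq⟩ : ∃ N, nz ≤ N ∧ nw ≤ N ∧ p ≤ N ∧ q ≤ N :=
    ⟨nz + nw + p + q, by omega, by omega, by omega, by omega⟩
  have hx : resizeIsometry hp (u₁ - u₂) ≠ 0 :=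
    (map_ne_zero_iff _ (resizeIsometry _).injective).2 (sub_ne_zero.2 hu)
  have hzu := coversPair_mimoSRG hp hz G.zu hu
  have hyu := coversPair_mimoSRG hp hq G.yu hu
  have hEz : ∀ v, loopMap G Φ 1 (E v) = v := fun v => (hE _ _).2 rfl
  have hprod : CoversPair (improvedMul (improvedMul (mimoSRG G.yw) (setInv (loopSRG G Φ 1)))
      (mimoSRG G.zu)) (resizeIsometry hp (u₁ - u₂))
      (resizeIsometry hq (G.yw (Φ (E (G.zu u₁))) - G.yw (Φ (E (G.zu u₂))))) := by
    -- If `Δw = 0` the product rule does not apply, and `0` must be exhibited in the product set.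
    -- Since `0 · ∞ = ∞`, a zero factor helps only beside finite ones: either `Δz = 0` and `0` lies
    -- in the SRG of `G_zu`, or `Φ` identifies two distinct inputs and `0` lies in the inverted loop
    -- bound.
    rcases eq_or_ne (Φ (E (G.zu u₁))) (Φ (E (G.zu u₂))) with hΦe | hΦe
    · obtain ⟨g, hg⟩ := mimoSRG_nonempty hnw G.yw
      obtain ⟨c, a, hc, ha, h0⟩ : ∃ c a : ℂ, (c : OnePoint ℂ) ∈ mimoSRG G.zu ∧
          (a : OnePoint ℂ) ∈ setInv (loopSRG G Φ 1) ∧ a * c = 0 := by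
        rcases eq_or_ne (G.zu u₁) (G.zu u₂) with hzz | hzz
        · obtain ⟨a, ha⟩ := (loopSRG_nonempty (G := G) (Φ := Φ) hnz hnw 1).image extInv
          obtain ⟨a', rfl⟩ := hfin a ha
          exact ⟨0, a', zero_mem_mimoSRG hu hzz, ha, mul_zero _⟩
        · refine ⟨_, 0, hzu 1 (Or.inl rfl), zero_mem_setInv_loopSRG hnw 1 (fun h' => hzz ?_) hΦe,
            zero_mul _⟩
          rw [← hEz (G.zu u₁), h', hEz]
      intro σ _
      rw [hΦe, sub_self, map_zero, srgPoint_zero_right]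
      have := setMul_subset_improvedMul _ _ (coe_mul_mem_setMul
        (setMul_subset_improvedMul _ _ (coe_mul_mem_setMul hg ha)) hc)
      rwa [mul_assoc, h0, mul_zero] at this
    · have hzz : G.zu u₁ ≠ G.zu u₂ := fun h' => hΦe (by rw [h'])
      have hloop := coversPair_loopSRG (G := G) hz hw zero_le_one hΦe
      rw [hEz, hEz] at hloop
      have h1 : resizeIsometry hw (Φ (E (G.zu u₁)) - Φ (E (G.zu u₂))) ≠ 0 :=
        (map_ne_zero_iff _ (resizeIsometry _).injective).2 (sub_ne_zero.2 hΦe)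
      have h2 : resizeIsometry hz (G.zu u₁ - G.zu u₂) ≠ 0 :=
        (map_ne_zero_iff _ (resizeIsometry _).injective).2 (sub_ne_zero.2 hzz)
      exact ((coversPair_mimoSRG hw hq G.yw hΦe).improvedMul h2 h1 (hloop.setInv h1 h2)).improvedMul
        hx h2 hzu
  have hall := hyu.improvedAdd hx hprod
  obtain ⟨c, hc, hle⟩ := exists_coe_of_radius_le h (hall 1 (Or.inl rfl))
  rw [← OnePoint.coe_injective hc, norm_srgPoint, ← map_add, LinearIsometry.norm_map,
    LinearIsometry.norm_map, div_le_iff₀ (norm_pos_iff.2 (sub_ne_zero.2 hu))] at hle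
  refine le_trans (le_of_eq ?_) hle
  congr 1
  abel

/-- From `‖k + g a c‖ ≤ Γ` with fixed nonzero `g`, `c` one solves for `‖a‖`. The SRGs of the blocks
of `G` do not involve `τ`, hence neither does the bound. -/
theorem exists_uniform_bound (hp : 0 < p) {Γ : ℝ≥0}
    (hbound : ∀ τ ∈ Icc (0 : ℝ) 1, radius (lfrSRGBound G Φ τ) ≤ Γ)
    (hyw : G.yw ≠ fun _ => 0) (hzu : G.zu ≠ fun _ => 0) :
    ∃ M : ℝ, 0 ≤ M ∧
      ∀ τ ∈ Icc (0 : ℝ) 1, ∀ a ∈ setInv (loopSRG G Φ τ), ∃ c : ℂ, a = c ∧ ‖c‖ ≤ M := by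
  have hne : ∀ {m n : ℕ} (A : RHInfty (Fin n) (Fin m)), A.op ≠ (fun _ => 0) →
      ∃ c : ℂ, (c : OnePoint ℂ) ∈ mimoSRG A.op ∧ 0 < ‖c‖ := by
    intro m n A hA
    obtain ⟨u, hu⟩ := Function.ne_iff.1 hA
    have h0 : A.op 0 = 0 := map_zero A.opL
    have hu0 : u ≠ 0 := fun h => hu (by rw [h, h0])
    obtain ⟨c, hc, hn⟩ := exists_coe_mem_mimoSRG (R := A.op) hu0
    refine ⟨c, hc, ?_⟩
    rw [hn, h0, sub_zero, sub_zero]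
    exact div_pos (norm_pos_iff.2 hu) (norm_pos_iff.2 hu0)
  obtain ⟨k, hk⟩ := mimoSRG_nonempty hp G.yu
  obtain ⟨g, hg, hg0⟩ := hne _ hyw
  obtain ⟨c, hc, hc0⟩ := hne _ hzu
  refine ⟨(Γ + ‖k‖) / (‖g‖ * ‖c‖), by positivity, fun τ hτ a ha => ?_⟩
  obtain ⟨a', rfl, hle⟩ := exists_coe_of_mem_setInv_loopSRG (hbound τ hτ) hk hg hc ha
  refine ⟨a', rfl, ?_⟩
  rw [le_div_iff₀ (by positivity)]
  have h1 : ‖g * a' * c‖ ≤ ‖k + g * a' * c‖ + ‖k‖ := by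
    simpa using norm_sub_le (k + g * a' * c) k
  rw [norm_mul, norm_mul] at h1
  linarith [mul_comm ‖a'‖ (‖g‖ * ‖c‖), mul_right_comm ‖g‖ ‖a'‖ ‖c‖]

/-- A vanishing block contributes a zero factor; the loop bound contains only finite points, so `k +
g a c` reduces to `k`, whose modulus is the incremental quotient of `G_yu`. -/
theorem norm_yu_sub_le (hnz : 0 < nz) (hnw : 0 < nw) (hp : 0 < p) {τ : ℝ} {Γ : ℝ≥0}
    (h : radius (lfrSRGBound G Φ τ) ≤ Γ) (h0 : G.yw = (fun _ => 0) ∨ G.zu = (fun _ => 0))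
    {u₁ u₂ : L2 p} (hu : u₁ ≠ u₂) : ‖G.yu u₁ - G.yu u₂‖ ≤ Γ * ‖u₁ - u₂‖ := by
  obtain ⟨k, hk, hkn⟩ := exists_coe_mem_mimoSRG (R := G.yu) hu
  obtain ⟨a, ha⟩ := (loopSRG_nonempty (G := G) (Φ := Φ) hnz hnw τ).image extInv
  obtain ⟨g, c, hg, hc, hgc⟩ : ∃ g c : ℂ, (g : OnePoint ℂ) ∈ mimoSRG G.yw ∧
      (c : OnePoint ℂ) ∈ mimoSRG G.zu ∧ g * c = 0 := by
    obtain ⟨w, hw⟩ := nontrivial_L2 hnw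
    obtain ⟨g, hg⟩ := mimoSRG_nonempty hnw G.yw
    obtain ⟨c, hc⟩ := mimoSRG_nonempty hp G.zu
    rcases h0 with h0 | h0
    · exact ⟨0, c, zero_mem_mimoSRG hw (by rw [h0]), hc, zero_mul _⟩
    · exact ⟨g, 0, hg, zero_mem_mimoSRG hu (by rw [h0]), mul_zero _⟩
  obtain ⟨a', -, hle⟩ := exists_coe_of_mem_setInv_loopSRG h hk hg hc ha
  rw [mul_right_comm, hgc, zero_mul, add_zero, hkn,
    div_le_iff₀ (norm_pos_iff.2 (sub_ne_zero.2 hu))] at hle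
  exact hle

end Loop

/-! ### The two cases of the theorem. -/

theorem mainTheorem1 {nz nw p q : ℕ} (hnz : 0 < nz) (hnw : 0 < nw) (hp : 0 < p) (hq : 0 < q)
    (G : LFRPlant nz nw p q) (Φ : L2 nz → L2 nw) (hΦ : incGain Φ < ⊤) (Γhat : ℝ≥0)
    (hbound : ∀ τ ∈ Icc (0 : ℝ) 1, radius (lfrSRGBound G Φ τ) ≤ Γhat) :
    (G.yw ≠ (fun _ => 0) → G.zu ≠ (fun _ => 0) →
      WellPosed Φ (fun w => -G.zw w) ∧
      (IsCausal Φ → WellPosedExtended Φ (fun w => -G.zw w)) ∧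
      ∃ R : L2 p → L2 q, lfrRelation G Φ = Function.graph R ∧
        incGain R ≤ Γhat ∧ (IsCausal Φ → IsCausal R)) ∧
    ((G.yw = (fun _ => 0) ∨ G.zu = (fun _ => 0)) →
      (incGain G.yu ≤ Γhat ∧ IsCausal G.yu) ∧
      (WellPosed Φ (fun w => -G.zw w) →
        ∃ R : L2 p → L2 q, lfrRelation G Φ = Function.graph R ∧
          incGain R ≤ Γhat ∧ (IsCausal Φ → IsCausal R))) := by

  have h01 : (1 : ℝ) ∈ Icc (0 : ℝ) 1 := ⟨zero_le_one, le_rfl⟩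
  have hinv : Function.Bijective (loopMap G Φ 1) →
      ∃ E : L2 nz → L2 nz, ∀ e v, loopMap G Φ 1 e = v ↔ e = E v := fun hbij =>
    ⟨(Equiv.ofBijective _ hbij).symm, fun e v =>
      (Equiv.eq_symm_apply (Equiv.ofBijective _ hbij)).symm⟩
  refine ⟨fun hyw hzu => ?_, fun h0 => ⟨⟨?_, isCausal_yu⟩, fun hwp => ?_⟩⟩
  · obtain ⟨M, hM0, hM⟩ := exists_uniform_bound hp hbound hyw hzu
    have hbij := loopMap_bijective hΦ hM0 hM
    obtain ⟨E, hE⟩ := hinv hbij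
    have hcinj := fun hc : IsCausal Φ => fun (T : ℝ≥0) (x y : L2 nz) =>
      trunc_eq_of_trunc_loopMap_eq (x := x) (y := y) hΦ hM0 hM hc T
    refine ⟨wellPosed_iff_bijective.2 hbij,
      fun hc => wellPosedExtended_of_causal_inverse hc hbij.2 (hcinj hc),
      _, lfrRelation_eq_graph hE, incGain_le fun x y hxy =>
        norm_lfr_sub_le hnz hnw (hbound 1 h01) hE
          (fun a ha => (hM 1 h01 a ha).imp fun _ h => h.1) hxy,
      fun hc => isCausal_lfr hc fun v T => hcinj hc T _ _ ?_⟩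
    -- Causality of `E`: the inputs `v` and `P_T v` are the loop outputs of `E v` and `E (P_T v)`,
    -- and have the same truncation.
    rw [(hE _ _).2 rfl, (hE _ _).2 rfl, trunc_trunc]
  · exact incGain_le fun x y hxy => norm_yu_sub_le hnz hnw hp (hbound 1 h01) h0 hxy
  · obtain ⟨E, hE⟩ := hinv (wellPosed_iff_bijective.1 hwp)
    -- The feedback path is constant but perhaps nonzero, since `Φ` need not fix `0`; a constant
    -- affects neither the gain nor causality.
    obtain ⟨y₀, hy₀⟩ : ∃ y₀, ∀ u, G.yw (Φ (E (G.zu u))) = y₀ := by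
      rcases h0 with h0 | h0
      · exact ⟨0, fun u => by rw [h0]⟩
      · exact ⟨G.yw (Φ (E 0)), fun u => by rw [h0]⟩
    refine ⟨_, lfrRelation_eq_graph hE, ?_, fun _ u T => ?_⟩
    · refine incGain_le fun x y hxy => ?_
      rw [hy₀, hy₀, add_sub_add_left_eq_sub]
      exact norm_yu_sub_le hnz hnw hp (hbound 1 h01) h0 hxy
    · simp only [hy₀]
      change truncL T _ = truncL T _
      rw [map_add, map_add]
      exact congrArg _ (isCausal_yu u T)
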